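/- Let $\xi\in(0,1)$ and $\lambda_B,\lambda_C>0$ with $\lambda_B+\lambda_C=1$. Let $f:[0,1+\xi)\to[0,1+\xi)$ be the interval exchange of three intervals with lengths $(\lambda_A,\lambda_B,\lambda_C)=(\xi,\lambda_B,\lambda_C)$ and permutation $\begin{pmatrix}A&B&C\\C&B&A\end{pmatrix}$, that is, $f(x)=x+\lambda_B+\lambda_C$ on $[0,\xi)$, $f(x)=x+\lambda_C-\xi$ on $[\xi,\xi+\lambda_B)$, and $f(x)=x-\xi-\lambda_B$ on $[\xi+\lambda_B,1+\xi)$. Put $$\alpha=\begin{cases}\lambda_C-\xi&\text{if }\lambda_C>\xi,\\ 1+\lambda_C-\xi&\text{if }\lambda_C<\xi\end{cases}$$ (the case $\lambda_C=\xi$ is excluded), let $q_0,q_1,\dots$ be the denominators of the continued fraction convergents of $\alpha$, and let $\|x\|=\min_{n\in\mathbb Z}|x-n|$. Suppose that $\alpha$ is badly approximable, i.e. $\alpha$ is irrational and there is $C_\alpha>0$ with $q_{m+1}\le C_\alpha q_m$ for all $m$, and that $\xi\in S_\alpha$, i.e. there is $C_\xi>0$ such that $\|\xi-j\alpha\|\ge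 C_\xi/q_n$ for all $n$ and all integers $j$ with $-q_n<j<q_n$. Then the metric slow entropy of $f$ with respect to normalized Lebesgue measure $\mathrm{Leb}$ on $[0,1+\xi)$, at the polynomial scale $a_\chi(n)=n^\chi$, satisfies $$h_{\mathrm{Leb},a_\chi}(f)=1 .$$ Here, for a probability measure $\mu$ on $X$ preserved by $f:X\to X$ and a finite measurable partition $\mathcal P$ of $X$, let $\bar d^{\,n}_{f,\mathcal P}(x,y)$ be the proportion of times $0\le s\le n-1$ at which $f^s(x)$ and $f^s(y)$ lie in different atoms of $\mathcal P$, let $B^n_{f,\mathcal P}(x,\epsilon)=\{y:\bar d^{\,n}_{f,\mathcal P}(x,y)<\epsilon\}$, and let $S_{f,\mathcal P}(\epsilon,n)$ be the least cardinality of a finite set $F\subset X$ with $\mu\big(\bigcup_{x\in F}B^n_{f,\mathcal P}(x,\epsilon)\big)>1-\epsilon$. Then $$h_{\mu,a_\chi}(f)=\sup_{\mathcal P}\ \lim_{\epsilon\to0^+}\ \sup\Big\{\chi\ge0:\ \limsup_{n\to\infty}\frac{S_{f,\mathcal P}(\epsilon,n)}{a_\chi(n)}>0\Big\},$$ where the outer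 supremum is over all finite measurable partitions and $\sup\emptyset=0$. -/

import Mathlib

open Filter Topology MeasureTheory
open scoped NNReal ENNReal

noncomputable section

namespace SlowEntropy

/-! ### Metric slow entropy -/

section MetricSlowEntropy

variable {X : Type*}

/-- The Hamming distance `1 - #{0 ≤ s ≤ n - 1 : x_s = y_s} / n`. A partition of `X` into `k` sets is
given by its labelling map `P : X → Fin k`, whose fibres are the atoms, so that `x_s = P (f^s x)`. -/
def orbitHammingDist {k : ℕ} (f : X → X) (P : X → Fin k) (n : ℕ) (x y : X) : ℝ :=
  1 - ((Finset.range n).filter fun s => P (f^[s] x) = P (f^[s] y)).card / (n : ℝ)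

/-- The `(ε, n)`-Hamming ball centred at `x`. -/
def hammingBall {k : ℕ} (f : X → X) (P : X → Fin k) (n : ℕ) (x : X) (ε : ℝ) : Set X :=
  {y | orbitHammingDist f P n x y < ε}

variable [MeasurableSpace X]

/-- The minimal cardinality of a finite set of centres whose `(ε, n)`-Hamming balls cover a set of
measure greater than `1 - ε`. -/
def coverNumber {k : ℕ} (μ : Measure X) (f : X → X) (P : X → Fin k) (ε : ℝ) (n : ℕ) : ℕ∞ :=
  ⨅ (F : Finset X) (_ : 1 - ε < μ.real (⋃ x ∈ F, hammingBall f P n x ε)), (F.card : ℕ∞)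

/-- `limsup_{n → ∞} S(ε, n) / a_χ(n)`, with values in `[0, ∞]`. -/
def growth {k : ℕ} (a : ℝ≥0 → ℕ → ℝ) (μ : Measure X) (f : X → X) (P : X → Fin k)
    (χ : ℝ≥0) (ε : ℝ) : ℝ≥0∞ :=
  limsup (fun n : ℕ => (coverNumber μ f P ε n : ℝ≥0∞) / ENNReal.ofReal (a χ n)) atTop

/-- `sup {χ ≥ 0 : limsup_{n → ∞} S(ε, n) / a_χ(n) > 0}` in `[0, ∞]`, where `sup ∅ = 0`. -/
def criticalExponent {k : ℕ} (a : ℝ≥0 → ℕ → ℝ) (μ : Measure X) (f : X → X) (P : X → Fin k)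
    (ε : ℝ) : ℝ≥0∞ :=
  ⨆ (χ : ℝ≥0) (_ : 0 < growth a μ f P χ ε), (χ : ℝ≥0∞)

/-- The slow metric entropy for the partition `P`, that is the limit of `criticalExponent` as
`ε → 0+`. The limit always exists (`tendsto_criticalExponent`), so it is the upper limit. -/
def metricSlowEntropyPartition {k : ℕ} (a : ℝ≥0 → ℕ → ℝ) (μ : Measure X) (f : X → X)
    (P : X → Fin k) : ℝ≥0∞ :=
  limsup (fun ε : ℝ => criticalExponent a μ f P ε) (𝓝[>] 0)

/-- The slow metric entropy of `f` with respect to `μ` at the scale `a`: the supremum over all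
finite measurable partitions. -/
def metricSlowEntropy (a : ℝ≥0 → ℕ → ℝ) (μ : Measure X) (f : X → X) : ℝ≥0∞ :=
  ⨆ (k : ℕ) (P : X → Fin k) (_ : Measurable P), metricSlowEntropyPartition a μ f P

theorem criticalExponent_antitone {k : ℕ} (a : ℝ≥0 → ℕ → ℝ) (μ : Measure X)
    [IsFiniteMeasure μ] (f : X → X) (P : X → Fin k) :
    Antitone (criticalExponent a μ f P) := by
  intro ε ε' h
  have hS : ∀ n, coverNumber μ f P ε' n ≤ coverNumber μ f P ε n := by
    intro n
    refine le_iInf₂ fun F hF => iInf₂_le F ?_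
    refine lt_of_le_of_lt (by linarith) (lt_of_lt_of_le hF (measureReal_mono ?_ (measure_ne_top _ _)))
    exact Set.iUnion₂_mono fun x _ y hy => lt_of_lt_of_le hy h
  refine iSup₂_le fun χ hχ => le_iSup₂_of_le χ (lt_of_lt_of_le hχ ?_) le_rfl
  refine limsup_le_limsup (Eventually.of_forall fun n => ?_)
  exact ENNReal.div_le_div_right (ENat.toENNReal_le.2 (hS n)) _

theorem tendsto_criticalExponent {k : ℕ} (a : ℝ≥0 → ℕ → ℝ) (μ : Measure X)
    [IsFiniteMeasure μ] (f : X → X) (P : X → Fin k) :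
    Tendsto (criticalExponent a μ f P) (𝓝[>] 0) (𝓝 (metricSlowEntropyPartition a μ f P)) := by
  have h := (criticalExponent_antitone a μ f P).tendsto_nhdsGT 0
  rw [metricSlowEntropyPartition, h.limsup_eq]
  exact h

/-- The polynomial scale `a_χ(n) = n ^ χ`. -/
def polynomialScale (χ : ℝ≥0) (n : ℕ) : ℝ := (n : ℝ) ^ (χ : ℝ)

end MetricSlowEntropy

/-! ### Interval exchanges of three intervals -/

/-- The 3-IET on `[0, a + b + c)` with length vector `(a, b, c)` and the symmetric permutation
`(A B C / C B A)`. -/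
def threeIET (a b c : ℝ) (ha : 0 < a) (hb : 0 < b) (hc : 0 < c) :
    Set.Ico (0 : ℝ) (a + b + c) → Set.Ico (0 : ℝ) (a + b + c) := fun x =>
  ⟨if (x : ℝ) < a then x + b + c else if (x : ℝ) < a + b then x + c - a else x - a - b, by
    obtain ⟨x, h0, h1⟩ := x
    dsimp only
    split_ifs <;> constructor <;> linarith⟩

/-- The normalized Lebesgue measure `L⁻¹ • Leb` on the interval `[0, L)`. -/
def normalizedLebesgue (L : ℝ) : Measure (Set.Ico (0 : ℝ) L) :=
  (ENNReal.ofReal L)⁻¹ • (volume : Measure ℝ).comap Subtype.val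

theorem isProbabilityMeasure_normalizedLebesgue {L : ℝ} (hL : 0 < L) :
    IsProbabilityMeasure (normalizedLebesgue L) := by
  constructor
  rw [normalizedLebesgue, Measure.smul_apply, smul_eq_mul,
    comap_subtype_coe_apply measurableSet_Ico, Set.image_univ, Subtype.range_coe, Real.volume_Ico,
    sub_zero]
  exact ENNReal.inv_mul_cancel (by simpa using hL) ENNReal.ofReal_ne_top

/-! ### Diophantine conditions -/

/-- The distance `‖x‖` from `x` to the nearest integer. -/
def distInt (x : ℝ) : ℝ := |x - round x|

/-- The denominator `q_n` of the `n`-th convergent of the continued fraction of `α`. -/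
def convDen (α : ℝ) (n : ℕ) : ℝ := (GenContFract.of α).dens n

/-- `α` is irrational and `q_{m+1} ≤ C q_m` for all `m`, for some constant `C`. -/
def BadlyApproximable (α : ℝ) : Prop :=
  Irrational α ∧ ∃ C : ℝ, 0 < C ∧ ∀ m : ℕ, convDen α (m + 1) ≤ C * convDen α m

/-- The set `S_α` of all `ξ` such that, for some constant `C > 0` (independent of `n` and `j`),
`‖ξ - j α‖ ≥ C / q_n` for all `n` and all integers `-q_n < j < q_n`. -/
def wellSeparated (α : ℝ) : Set ℝ :=
  {ξ | ∃ C : ℝ, 0 < C ∧ ∀ (n : ℕ) (j : ℤ), -convDen α n < j → (j : ℝ) < convDen α n →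
    C / convDen α n ≤ distInt (ξ - j * α)}

/-- The rotation number `c - ξ` if `c > ξ` and `1 + c - ξ` if `c < ξ`. For `c = ξ`, where the
rotation is trivial, the value is the integer `1`, which is not badly approximable. -/
def rotationNumber (ξ c : ℝ) : ℝ := if ξ < c then c - ξ else 1 + c - ξ

end SlowEntropy

end

namespace SlowEntropy

/-! ### Diophantine estimates -/

/-! Since `b + c = 1`, modulo `1` the exchange fixes the points of `[0, ξ)` and rotates all other
points by `α`. Thus an orbit is a rotation orbit in which every visit to `[0, ξ)` costs one extra
unit of time.

Lower bound. Let two orbits be at distance `δ`. They stay parallel until a discontinuity falls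
between them, which happens within time `O(1/δ)` because orbits of a badly approximable rotation are
`δ`-dense by then (`length_mul_le_of_close`). The crossing makes one orbit lag the other by one
step, and the lag keeps them a definite distance apart. A second crossing would force `kα` or `ξ -
kα` to be within `δ` of an integer; bad approximability and `ξ ∈ S_α` exclude this for a time of
order `1/δ` (`le_abs_sub_after_crossing`). So each close run is followed by a far run of comparable
length. If far times are rare up to `n`, a single close run fills most of `[0, n)`
(`exists_long_run`), and then `δ = O(1/n)` at the midpoint. By invariance, Hamming balls for a fine
partition into cells have measure `O(1/n)`, so about `n` of them are needed.

Upper bound. Every partition is approximated in measure by one into unions of cells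
(`exists_cell_approximation`). Cell itineraries of length `n` change only at preimages of boundedly
many points, so there are `O(n)` of them (`exists_linear_coding`). By Markov's inequality most
orbits follow these itineraries with few errors, so `O(n)` balls suffice. -/

theorem exists_int_eq_nums_dens (α : ℝ) (n : ℕ) :
    (∃ p : ℤ, (GenContFract.of α).nums n = p) ∧ ∃ q : ℤ, (GenContFract.of α).dens n = q := by
  suffices h : ∀ n, ((∃ p : ℤ, ((GenContFract.of α).contsAux n).a = p) ∧
      ∃ q : ℤ, ((GenContFract.of α).contsAux n).b = q) from h (n + 1)
  intro n
  induction n using Nat.twoStepInduction with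
  | zero => exact ⟨⟨1, by simp [GenContFract.contsAux]⟩, ⟨0, by simp [GenContFract.contsAux]⟩⟩
  | one => exact ⟨⟨⌊α⌋, by simp [GenContFract.contsAux]⟩, ⟨1, by simp [GenContFract.contsAux]⟩⟩
  | more n ih₀ ih₁ =>
    rcases h : (GenContFract.of α).s.get? n with _ | gp
    · rw [show (GenContFract.of α).contsAux (n + 2) = (GenContFract.of α).contsAux (n + 1) by
        simp [GenContFract.contsAux, h]]
      exact ih₁
    · obtain ⟨ha, z, hz⟩ := GenContFract.of_partNum_eq_one_and_exists_int_partDen_eq h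
      rw [GenContFract.contsAux_recurrence h rfl rfl]
      obtain ⟨⟨p₀, hp₀⟩, q₀, hq₀⟩ := ih₀
      obtain ⟨⟨p₁, hp₁⟩, q₁, hq₁⟩ := ih₁
      exact ⟨⟨z * p₁ + p₀, by simp [ha, hz, hp₀, hp₁]⟩, ⟨z * q₁ + q₀, by simp [ha, hz, hq₀, hq₁]⟩⟩

theorem not_terminatedAt_of_irrational {α : ℝ} (hα : Irrational α) (n : ℕ) :
    ¬(GenContFract.of α).TerminatedAt n := fun h =>
  let ⟨q, hq⟩ := (GenContFract.terminates_iff_rat α).1 ⟨n, h⟩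
  hα ⟨q, hq.symm⟩

/-- Only unboundedness of the denominators is used; the `4` absorbs the indices below the range of
`Nat.le_fib_self`. -/
theorem le_convDen {α : ℝ} (hα : Irrational α) (n : ℕ) : (n : ℝ) ≤ convDen α n + 4 := by
  have h₁ : (Nat.fib (n + 1) : ℝ) ≤ convDen α n :=
    GenContFract.succ_nth_fib_le_of_nth_den (Or.inr (not_terminatedAt_of_irrational hα _))
  have h₂ : n ≤ Nat.fib (n + 1) + 4 := by
    rcases le_or_gt 5 (n + 1) with h | h
    · have := Nat.le_fib_self h; omega
    · omega
  have h₃ : (n : ℝ) ≤ Nat.fib (n + 1) + 4 := by exact_mod_cast h₂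
  linarith

theorem convDen_zero (α : ℝ) : convDen α 0 = 1 := GenContFract.zeroth_den_eq_one

theorem convDen_mono (α : ℝ) : Monotone (convDen α) :=
  monotone_nat_of_le_succ fun _ => GenContFract.of_den_mono

theorem one_le_convDen (α : ℝ) (n : ℕ) : 1 ≤ convDen α n :=
  convDen_zero α ▸ convDen_mono α n.zero_le

/-- The first convergent denominator exceeding `t` is at most `C * t` if all ratios are `≤ C`. -/
theorem exists_convDen_between {α C : ℝ} (hα : Irrational α)
    (hC : ∀ m, convDen α (m + 1) ≤ C * convDen α m) (h0 : 0 < C) {t : ℝ} (ht : 1 ≤ t) :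
    ∃ n, t < convDen α n ∧ convDen α n ≤ C * t := by
  classical
  have hex : ∃ n, t < convDen α n := by
    obtain ⟨n, hn⟩ := exists_nat_gt (t + 4)
    exact ⟨n, by linarith [le_convDen hα n]⟩
  refine ⟨Nat.find hex, Nat.find_spec hex, ?_⟩
  rcases h : Nat.find hex with _ | m
  · have := Nat.find_spec hex
    rw [h, convDen_zero] at this
    linarith
  · have : convDen α m ≤ t := not_lt.1 (Nat.find_min hex (by omega))
    exact (hC m).trans (by gcongr)

/-- Compare `p / k` with a convergent `P / Q`, where `2k < Q ≤ 2Ck`. If they differ, `|kP - pQ| ≥ 1`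
while `k|Qα - P| ≤ 1/2`, so `Q|kα - p| ≥ 1/2`. If they agree, the determinant identity makes the
next convergent differ, and its denominator is at most `2C²k`. -/
theorem BadlyApproximable.exists_le_mul_abs_sub {α : ℝ} (hα : BadlyApproximable α) :
    ∃ c : ℝ, 0 < c ∧ ∀ k : ℕ, 1 ≤ k → ∀ p : ℤ, c ≤ k * |k * α - p| := by
  obtain ⟨hirr, C, hC0, hC⟩ := hα
  have hC1 : 1 ≤ C := by
    have h₁ := hC 0
    have h₂ := one_le_convDen α 1
    rw [convDen_zero] at h₁
    simpa using h₂.trans h₁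
  refine ⟨1 / (4 * C ^ 2), by positivity, fun k hk p => ?_⟩
  have hk1 : (1 : ℝ) ≤ k := by exact_mod_cast hk
  obtain ⟨n, hn₁, hn₂⟩ := exists_convDen_between hirr hC hC0 (t := 2 * k) (by linarith)
  have key : ∀ i, n ≤ i → convDen α i ≤ 2 * C ^ 2 * k → ∀ P Q : ℤ,
      (GenContFract.of α).nums i = P → convDen α i = Q → p * Q ≠ k * P →
      1 / (4 * C ^ 2) ≤ k * |k * α - p| := by
    intro i hi hle P Q hP hQ hne
    have hpos := one_le_convDen α i
    have h₁ : |convDen α i * α - P| ≤ 1 / convDen α (i + 1) := by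
      have h := GenContFract.abs_sub_convs_le (not_terminatedAt_of_irrational hirr i)
      rw [GenContFract.conv_eq_num_div_den, hP] at h
      change |α - P / convDen α i| ≤ 1 / (convDen α i * convDen α (i + 1)) at h
      have h' : convDen α i * α - P = convDen α i * (α - P / convDen α i) := by field_simp
      rw [h', abs_mul, abs_of_pos (by linarith)]
      calc _ ≤ convDen α i * (1 / (convDen α i * convDen α (i + 1))) := by gcongr
        _ = _ := by field_simp
    have h₂ : 1 / convDen α (i + 1) ≤ 1 / (2 * k) :=
      one_div_le_one_div_of_le (by linarith) (hn₁.le.trans (convDen_mono α (by omega)))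
    have h₃ : (1 : ℝ) ≤ |(k : ℝ) * P - p * Q| := by
      have : (1 : ℤ) ≤ |(k : ℤ) * P - p * Q| := Int.one_le_abs (sub_ne_zero.2 hne.symm)
      exact_mod_cast this
    have h₄ : convDen α i * |k * α - p| ≥ 1 / 2 := by
      have e : convDen α i * (k * α - p) =
          ((k : ℝ) * P - p * Q) + k * (convDen α i * α - P) := by rw [hQ]; ring
      have h₅ : |(k : ℝ) * (convDen α i * α - P)| ≤ 1 / 2 := by
        rw [abs_mul, abs_of_pos (by linarith)]
        calc _ ≤ (k : ℝ) * (1 / (2 * k)) := by gcongr; exact h₁.trans h₂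
          _ = _ := by field_simp
      have h₆ := abs_sub_abs_le_abs_sub ((k : ℝ) * P - p * Q) (-(k * (convDen α i * α - P)))
      rw [abs_neg, sub_neg_eq_add, ← e, abs_mul (convDen α i),
        abs_of_pos (by linarith : 0 < convDen α i)] at h₆
      linarith
    have h₅ : 1 / 2 ≤ 2 * C ^ 2 * k * |k * α - p| := by
      refine h₄.le.trans ?_
      gcongr
    rw [div_le_iff₀ (by positivity)]
    linarith
  obtain ⟨⟨P, hP⟩, Q, hQ⟩ := exists_int_eq_nums_dens α n
  obtain ⟨⟨P', hP'⟩, Q', hQ'⟩ := exists_int_eq_nums_dens α (n + 1)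
  have hdet : P * Q' - Q * P' ≠ 0 := by
    have h := SimpContFract.determinant (s := SimpContFract.of α)
      (not_terminatedAt_of_irrational hirr n)
    change (GenContFract.of α).nums n * (GenContFract.of α).dens (n + 1) -
      (GenContFract.of α).dens n * (GenContFract.of α).nums (n + 1) = (-1) ^ (n + 1) at h
    rw [hP, hQ, hP', hQ'] at h
    intro h0
    have h0' : (P * Q' - Q * P' : ℝ) = 0 := by exact_mod_cast h0
    rw [h0'] at h
    exact absurd h.symm (by positivity)
  by_cases hne : p * Q = k * P
  · refine key (n + 1) (by omega) ?_ P' Q' hP' hQ' fun h => hdet ?_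
    · calc _ ≤ C * convDen α n := hC n
        _ ≤ C * (C * (2 * k)) := by gcongr
        _ = _ := by ring
    · have hk0 : (k : ℤ) ≠ 0 := by omega
      have : (k : ℤ) * (P * Q' - Q * P') = 0 := by linear_combination Q * h - Q' * hne
      exact (mul_eq_zero.1 this).resolve_left hk0
  · refine key n le_rfl ?_ P Q hP hQ hne
    calc _ ≤ C * (2 * k) := hn₂
      _ ≤ C ^ 2 * (2 * k) := by gcongr; nlinarith
      _ = _ := by ring

/-- The separation at the first `q_n > |j| + 1` is used; since `q_n ≤ C (|j| + 1)`, the scale `q_n`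
can be replaced by `|j| + 1`. -/
theorem exists_le_mul_abs_sub_of_mem_wellSeparated {α ξ : ℝ} (hα : BadlyApproximable α)
    (hξ : ξ ∈ wellSeparated α) :
    ∃ c : ℝ, 0 < c ∧ ∀ j p : ℤ, c ≤ (|j| + 1) * |ξ - j * α - p| := by
  obtain ⟨hirr, C, hC0, hC⟩ := hα
  obtain ⟨c, hc0, hc⟩ := hξ
  refine ⟨c / C, by positivity, fun j p => ?_⟩
  have hj : (1 : ℝ) ≤ |(j : ℝ)| + 1 := by linarith [abs_nonneg (j : ℝ)]
  obtain ⟨n, hn₁, hn₂⟩ := exists_convDen_between hirr hC hC0 hj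
  have h := (hc n j (by linarith [neg_abs_le (j : ℝ)]) (by linarith [le_abs_self (j : ℝ)])).trans
    (round_le _ p)
  have hpos := one_le_convDen α n
  rw [div_le_iff₀ (by linarith)] at h
  rw [div_le_iff₀ hC0]
  push_cast
  calc c ≤ |ξ - j * α - p| * convDen α n := h
    _ ≤ |ξ - j * α - p| * (C * (|(j : ℝ)| + 1)) := by gcongr
    _ = _ := by ring

/-- The first `O(1 / δ)` points of an orbit of a badly approximable rotation meet every arc of
length `δ`. -/
theorem BadlyApproximable.exists_orbit_mem_Ico {α : ℝ} (hα : BadlyApproximable α) :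
    ∃ C : ℝ, 0 < C ∧ ∀ x y δ : ℝ, 0 < δ → δ ≤ 1 →
      ∃ (i : ℕ) (m : ℤ), (i : ℝ) ≤ C / δ ∧ x + i * α + m ∈ Set.Ico (y - δ) y := by
  obtain ⟨c, hc0, hc⟩ := hα.exists_le_mul_abs_sub
  refine ⟨3 / c + 1, by positivity, fun x y δ hδ hδ1 => ?_⟩
  -- Dirichlet's theorem with this `N` gives a fraction `p / q` with `c (N + 1) ≤ q ≤ N`, hence `q δ
  -- > 3`. Three units of `1 / q` are needed: a margin at the left end, the rounding to a multiple
  -- of `1 / q`, and the error of replacing `α` by `p / q` during fewer than `q` steps.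
  obtain ⟨N, hN₁, hN₂⟩ : ∃ N : ℕ, 3 / (c * δ) ≤ N ∧ (N : ℝ) ≤ 3 / (c * δ) + 1 :=
    ⟨⌈3 / (c * δ)⌉₊, Nat.le_ceil _, (Nat.ceil_lt_add_one (by positivity)).le⟩
  have hN0 : 0 < N := by
    have : (0 : ℝ) < N := lt_of_lt_of_le (by positivity) hN₁
    exact_mod_cast this
  obtain ⟨r, hr₁, hr₂⟩ := Real.exists_rat_abs_sub_le_and_den_le α hN0
  have hq0 : (0 : ℝ) < r.den := by exact_mod_cast r.pos
  have hqN : (r.den : ℝ) ≤ N := by exact_mod_cast hr₂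
  have hr : (r : ℝ) = r.num / r.den := by exact_mod_cast (Rat.num_div_den r).symm
  have herr : |r.den * α - r.num| ≤ 1 / (N + 1) := by
    have e : r.den * α - r.num = r.den * (α - r) := by rw [hr]; field_simp
    rw [e, abs_mul, abs_of_pos hq0]
    calc _ ≤ (r.den : ℝ) * (1 / ((N + 1) * r.den)) := by gcongr
      _ = _ := by field_simp
  have hqc : c * (N + 1) ≤ r.den := by
    have h := (hc r.den r.pos r.num).trans (mul_le_mul_of_nonneg_left herr hq0.le)
    rw [mul_one_div, le_div_iff₀ (by positivity)] at h
    exact h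
  have hqδ : 3 < r.den * δ := by
    have h := mul_le_mul_of_nonneg_right hN₁ (mul_pos hc0 hδ).le
    rw [div_mul_cancel₀ _ (by positivity)] at h
    nlinarith [mul_le_mul_of_nonneg_right hqc hδ.le, mul_pos hc0 hδ]
  -- `l / r.den` is close to `y - x`, and `i * r.num ≡ l` modulo `r.den`
  set l : ℤ := ⌈(y - x - δ) * r.den + 1⌉ with hl
  have hl₁ := Int.le_ceil ((y - x - δ) * r.den + 1)
  have hl₂ := Int.ceil_lt_add_one ((y - x - δ) * r.den + 1)
  rw [← hl] at hl₁ hl₂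
  obtain ⟨u, v, huv⟩ : ∃ u v : ℤ, u * r.num + v * r.den = 1 := by
    have : IsCoprime r.num (r.den : ℤ) := Rat.isCoprime_num_den r
    exact this
  have hqz : (0 : ℤ) < r.den := by exact_mod_cast r.pos
  have hi0 := Int.emod_nonneg (l * u) hqz.ne'
  have hi1 := Int.emod_lt_of_pos (l * u) hqz
  have hid := Int.emod_add_mul_ediv (l * u) r.den
  obtain ⟨i, hi⟩ := Int.eq_ofNat_of_zero_le hi0
  rw [hi] at hi1 hid
  have hmul : (i : ℤ) * r.num + (l * v + (l * u / r.den) * r.num) * r.den = l := by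
    linear_combination r.num * hid + l * huv
  have hiq : (i : ℝ) < r.den := by exact_mod_cast hi1
  refine ⟨i, l * v + (l * u / r.den) * r.num, ?_, ?_⟩
  · have : 1 ≤ 1 / δ := by rw [le_div_iff₀ hδ]; linarith
    calc (i : ℝ) ≤ 3 / (c * δ) + 1 := by linarith
      _ ≤ 3 / (c * δ) + 1 / δ := by linarith
      _ = _ := by field_simp
  · set m : ℤ := l * v + (l * u / r.den) * r.num
    have hmul' : (i : ℝ) * r.num + m * r.den = l := by exact_mod_cast hmul
    have hdiff : |(i * (r.den * α - r.num) : ℝ)| < 1 := by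
      rw [abs_mul, Nat.abs_cast]
      calc (i : ℝ) * |r.den * α - r.num| ≤ i * (1 / (N + 1)) := by gcongr
        _ < 1 := by rw [mul_one_div, div_lt_one (by positivity)]; linarith
    have e : (x + i * α + m) * r.den = x * r.den + l + i * (r.den * α - r.num) := by
      linear_combination hmul'
    rw [abs_lt] at hdiff
    constructor
    · refine le_of_mul_le_mul_right ?_ hq0
      rw [e]; nlinarith
    · refine lt_of_mul_lt_mul_right ?_ hq0.le
      rw [e]; nlinarith


/-! ### Pairs of orbits of a three interval exchange -/

/-- `X` is an orbit of the interval exchange with lengths `(ξ, b, c)`, as a real sequence. -/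
structure IsIETOrbit (ξ b c : ℝ) (X : ℕ → ℝ) : Prop where
  mem : ∀ s, X s ∈ Set.Ico 0 (ξ + b + c)
  succ : ∀ s, X (s + 1) = if X s < ξ then X s + b + c else
    if X s < ξ + b then X s + c - ξ else X s - ξ - b

section IETOrbit

variable {ξ b c α η : ℝ} {X Y : ℕ → ℝ}

namespace IsIETOrbit

theorem shift (hX : IsIETOrbit ξ b c X) (t : ℕ) : IsIETOrbit ξ b c fun s => X (t + s) :=
  ⟨fun s => hX.mem (t + s), fun s => hX.succ (t + s)⟩

theorem succ_of_lt (hX : IsIETOrbit ξ b c X) (hbc : b + c = 1) {s : ℕ} (h : X s < ξ) :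
    X (s + 1) = X s + 1 := by
  rw [hX.succ, if_pos h]; linarith

theorem succ_of_mem (hX : IsIETOrbit ξ b c X) {s : ℕ} (h : ξ ≤ X s) (h' : X s < ξ + b) :
    X (s + 1) = X s + c - ξ := by
  rw [hX.succ, if_neg h.not_gt, if_pos h']

theorem succ_of_le (hX : IsIETOrbit ξ b c X) (hb : 0 < b) {s : ℕ} (h : ξ + b ≤ X s) :
    X (s + 1) = X s - ξ - b := by
  rw [hX.succ, if_neg (by linarith), if_neg h.not_gt]

/-- Outside of the first interval the exchange is the rotation by `α`, modulo `1`. -/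
theorem succ_eq_add (hX : IsIETOrbit ξ b c X) (hb : 0 < b) (hbc : b + c = 1)
    (hα : ∃ e : ℤ, α = c - ξ + e) {s : ℕ} (h : ξ ≤ X s) : ∃ m : ℤ, X (s + 1) = X s + α + m := by
  obtain ⟨e, he⟩ := hα
  rcases lt_or_ge (X s) (ξ + b) with h' | h'
  · exact ⟨-e, by rw [hX.succ_of_mem h h', he]; push_cast; ring⟩
  · exact ⟨-e - 1, by rw [hX.succ_of_le hb h', he]; push_cast; linarith⟩

/-- Here `k` counts the steps made outside the first interval. The last clause excludes `k = 0`, for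
which the Diophantine bound on `kα` says nothing. -/
theorem eq_add_mul (hX : IsIETOrbit ξ b c X) (hb : 0 < b) (hbc : b + c = 1)
    (hα : ∃ e : ℤ, α = c - ξ + e) (s : ℕ) :
    ∃ (k : ℕ) (m : ℤ), X s = X 0 + k * α + m ∧ k ≤ s ∧ (ξ ≤ X 0 → 1 ≤ s → 1 ≤ k) := by
  induction s with
  | zero => exact ⟨0, 0, by simp, le_rfl, fun _ h => absurd h (by omega)⟩
  | succ s ih =>
    obtain ⟨k, m, h, hk, hk1⟩ := ih
    rcases lt_or_ge (X s) ξ with hs | hs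
    · refine ⟨k, m + 1, by rw [hX.succ_of_lt hbc hs, h]; push_cast; ring, by omega,
        fun h0 _ => hk1 h0 ?_⟩
      rcases s with _ | s
      · exact absurd h0 hs.not_ge
      · omega
    · obtain ⟨m', hm'⟩ := hX.succ_eq_add hb hbc hα hs
      exact ⟨k + 1, m + m', by rw [hm', h]; push_cast; ring, by omega, fun _ _ => by omega⟩

/-- A point below `ξ` moves to a point `≥ 1 > ξ`, so each rotation step takes at most two units of
time. -/
theorem exists_eq_add_mul (hX : IsIETOrbit ξ b c X) (hξ1 : ξ < 1) (hb : 0 < b) (hbc : b + c = 1)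
    (hα : ∃ e : ℤ, α = c - ξ + e) (i : ℕ) :
    ∃ (s : ℕ) (m : ℤ), s ≤ 2 * i ∧ X s = X 0 + i * α + m := by
  induction i with
  | zero => exact ⟨0, 0, by omega, by simp⟩
  | succ i ih =>
    obtain ⟨s, m, hs, h⟩ := ih
    rcases lt_or_ge (X s) ξ with hs' | hs'
    · have h₁ := hX.succ_of_lt hbc hs'
      obtain ⟨m', hm'⟩ := hX.succ_eq_add hb hbc hα (s := s + 1)
        (by linarith [(hX.mem s).1])
      exact ⟨s + 2, m + 1 + m', by omega, by rw [hm', h₁, h]; push_cast; ring⟩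
    · obtain ⟨m', hm'⟩ := hX.succ_eq_add hb hbc hα hs'
      exact ⟨s + 1, m + m', by omega, by rw [hm', h]; push_cast; ring⟩

/-- Two orbits keep their distance `δ` until a discontinuity falls between them. -/
theorem eq_add_of_not_crossing (hX : IsIETOrbit ξ b c X) (hY : IsIETOrbit ξ b c Y) (hb : 0 < b)
    (hbc : b + c = 1) {δ : ℝ} (hδ : 0 < δ) (h0 : Y 0 = X 0 + δ) {j : ℕ}
    (h₁ : ∀ i < j, Y i ∉ Set.Ico ξ (ξ + δ)) (h₂ : ∀ i < j, Y i ∉ Set.Ico (ξ + b) (ξ + b + δ)) :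
    Y j = X j + δ := by
  induction j with
  | zero => exact h0
  | succ j ih =>
    have hj := ih (fun i hi => h₁ i (by omega)) fun i hi => h₂ i (by omega)
    have h₁' := h₁ j (by omega)
    have h₂' := h₂ j (by omega)
    simp only [Set.mem_Ico, not_and, not_lt] at h₁' h₂'
    rcases lt_or_ge (Y j) ξ with h | h
    · rw [hY.succ_of_lt hbc h, hX.succ_of_lt hbc (by linarith), hj]; ring
    have h' := h₁' h
    rcases lt_or_ge (Y j) (ξ + b) with h'' | h''
    · rw [hY.succ_of_mem h h'', hX.succ_of_mem (by linarith) (by linarith), hj]; ring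
    · have := h₂' h''
      rw [hY.succ_of_le hb h'', hX.succ_of_le hb (by linarith), hj]; ring

/-- The three displacements are `1`, `c - ξ` and `-(ξ + b)`. This is what keeps two orbits apart
when one is a step behind the other. -/
theorem le_abs_succ_sub (hX : IsIETOrbit ξ b c X) (hξ : η ≤ ξ) (hb : 0 < b) (hbc : b + c = 1)
    (hcξ : η ≤ |c - ξ|) (h1 : η ≤ 1) (s : ℕ) : η ≤ |X (s + 1) - X s| := by
  rcases lt_or_ge (X s) ξ with h | h
  · rw [hX.succ_of_lt hbc h]; simpa using h1
  rcases lt_or_ge (X s) (ξ + b) with h' | h'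
  · rw [hX.succ_of_mem h h']
    rwa [show X s + c - ξ - X s = c - ξ by ring]
  · rw [hX.succ_of_le hb h', le_abs]
    right; linarith

/-- Once a pair of orbits at distance `δ` is separated, it stays apart for a time of order
`1 / δ`. -/
theorem le_abs_sub_after_crossing (hX : IsIETOrbit ξ b c X) (hY : IsIETOrbit ξ b c Y)
    (hbc : b + c = 1) (hα : ∃ e : ℤ, α = c - ξ + e) (hη0 : 0 < η) (hηξ : 2 * η ≤ ξ)
    (hηb : 2 * η ≤ b) (hηc : 2 * η ≤ c) (hηcξ : 2 * η ≤ |c - ξ|) {κ : ℝ}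
    (h₁ : ∀ k : ℕ, 1 ≤ k → ∀ p : ℤ, κ ≤ k * |k * α - p|)
    (h₂ : ∀ j p : ℤ, κ ≤ (|j| + 1) * |ξ - j * α - p|)
    (hlt : X 0 < Y 0) (hgood : Y 0 - X 0 < η) (hbad : η ≤ |Y 1 - X 1|) (j : ℕ)
    (hj : (j + 1) * (Y 0 - X 0) ≤ κ) : η ≤ |Y (1 + j) - X (1 + j)| := by
  obtain ⟨δ, hδ⟩ : ∃ δ, Y 0 = X 0 + δ := ⟨Y 0 - X 0, by ring⟩
  rw [show Y 0 - X 0 = δ by rw [hδ]; ring] at hj hgood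
  have hδ0 : 0 < δ := by linarith
  have hb : 0 < b := by linarith
  rcases j with _ | j
  · simpa using hbad
  push_cast at hj
  obtain ⟨e, he⟩ := hα
  have hrot : ∀ s, ξ ≤ Y 0 → 1 ≤ s → ∃ (k : ℕ) (m : ℤ), Y s = Y 0 + k * α + m ∧ k ≤ s ∧ 1 ≤ k :=
    fun s h0 hs => by
      obtain ⟨k, m, h, hk, hk1⟩ := hY.eq_add_mul hb hbc ⟨e, he⟩ s
      exact ⟨k, m, h, hk, hk1 h0 hs⟩
  have hκ : ∀ i < j, ((i : ℝ) + 3) * δ ≤ κ := fun i hi => by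
    have : (i : ℝ) + 1 ≤ j := by exact_mod_cast hi
    nlinarith
  have contra₁ : ∀ i < j, ∀ k : ℕ, 1 ≤ k → k ≤ i + 2 → ∀ p : ℤ, |k * α - p| < δ → False := by
    intro i hi k hk hki p hp
    have hk' : (1 : ℝ) ≤ k := by exact_mod_cast hk
    have hki' : (k : ℝ) ≤ i + 2 := by exact_mod_cast hki
    have := h₁ k hk p
    have := hκ i hi
    nlinarith
  have contra₂ : ∀ i < j, ∀ k p : ℤ, |k| + 1 ≤ i + 3 → |ξ - k * α - p| < δ → False := by
    intro i hi k p hki hp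
    have hki' : ((|k| : ℤ) : ℝ) + 1 ≤ i + 3 := by exact_mod_cast hki
    have hk0 : (0 : ℝ) ≤ ((|k| : ℤ) : ℝ) := by exact_mod_cast abs_nonneg k
    have := h₂ k p
    have := hκ i hi
    nlinarith
  rcases lt_or_ge (X 0) ξ with hA | hA
  · rcases lt_or_ge (Y 0) ξ with hYA | hYA
    · rw [show (1 : ℕ) = 0 + 1 by rfl, hX.succ_of_lt hbc hA, hY.succ_of_lt hbc hYA, hδ,
        show X 0 + δ + 1 - (X 0 + 1) = δ by ring, abs_of_pos hδ0] at hbad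
      linarith
    -- Crossing at `ξ`: `X` spends an extra step in the first interval and from then on lags `Y` by
    -- one.
    have hY1 := hY.succ_of_mem hYA (by linarith : Y 0 < ξ + b)
    have hX1 := hX.succ_of_lt hbc hA
    have hX2 := hX.succ_of_le hb (by linarith : ξ + b ≤ X 1)
    have key : Y (1 + j) = X (2 + j) + δ := by
      refine eq_add_of_not_crossing (hX.shift 2) (hY.shift 1) hb hbc hδ0 ?_ ?_ ?_
      · change Y 1 = X 2 + δ
        rw [zero_add] at hY1 hX1
        linarith
      · intro i hi hmem
        simp only [Set.mem_Ico] at hmem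
        obtain ⟨k, m, h, hk, hk1⟩ := hrot (1 + i) hYA (by omega)
        refine contra₁ i hi k hk1 (by omega) (-m) ?_
        rw [abs_lt]; push_cast; constructor <;> linarith
      · intro i hi hmem
        simp only [Set.mem_Ico] at hmem
        obtain ⟨k, m, h, hk, hk1⟩ := hrot (1 + i) hYA (by omega)
        -- Modulo `1` the discontinuity `ξ + b` is `-α`. Passing from near `ξ` to near `ξ + b` in
        -- `k` rotations therefore puts `ξ + (k + 1) α` near an integer.
        refine contra₂ i hi (-(k + 1)) (1 + e - m) ?_ ?_
        · rw [abs_neg, abs_of_nonneg (by positivity)]; omega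
        · rw [abs_lt]; push_cast; constructor <;> linarith
    -- One step moves a point by at least `2η`, and the lagged orbits differ by only `δ < η`, so at
    -- equal times the distance is at least `η`.
    have hd := hY.le_abs_succ_sub hηξ hb hbc hηcξ (by linarith) (1 + j)
    rw [show 1 + (j + 1) = 1 + j + 1 by ring, show X (1 + j + 1) = Y (1 + j) - δ by
      rw [key, show 2 + j = 1 + j + 1 by ring]; ring]
    have := abs_sub_abs_le_abs_sub (Y (1 + j + 1) - Y (1 + j)) (-δ)
    rw [abs_neg, abs_of_pos hδ0] at this
    rw [show Y (1 + j + 1) - (Y (1 + j) - δ) = Y (1 + j + 1) - Y (1 + j) - -δ by ring]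
    linarith
  · rcases lt_or_ge (Y 0) (ξ + b) with hYB | hYB
    · rw [show (1 : ℕ) = 0 + 1 by rfl, hX.succ_of_mem hA (by linarith),
        hY.succ_of_mem (by linarith) hYB, hδ,
        show X 0 + δ + c - ξ - (X 0 + c - ξ) = δ by ring, abs_of_pos hδ0] at hbad
      linarith
    have hY1 := hY.succ_of_le hb hYB
    rcases lt_or_ge (X 0) (ξ + b) with hXB | hXB
    swap
    · rw [show (1 : ℕ) = 0 + 1 by rfl, hX.succ_of_le hb hXB, hY1, hδ,
        show X 0 + δ - ξ - b - (X 0 - ξ - b) = δ by ring, abs_of_pos hδ0] at hbad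
      linarith
    have hX1 := hX.succ_of_mem hA hXB
    rw [zero_add] at hY1 hX1
    -- Crossing at `ξ + b`: `Y` lands just above `0`, in the first interval, and now it is `Y` that
    -- lags by one step.
    have hY2 := hY.succ_of_lt hbc (by linarith : Y 1 < ξ)
    have key : Y (2 + j) = X (1 + j) + δ := by
      refine eq_add_of_not_crossing (hX.shift 1) (hY.shift 2) hb hbc hδ0 ?_ ?_ ?_
      · change Y 2 = X 1 + δ
        linarith
      · intro i hi hmem
        simp only [Set.mem_Ico] at hmem
        obtain ⟨k, m, h, hk, hk1⟩ := hrot (2 + i) (by linarith) (by omega)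
        refine contra₂ i hi (k - 1) (m + 1 + e) ?_ ?_
        · rw [abs_of_nonneg (by omega)]; omega
        · rw [abs_lt]; push_cast; constructor <;> linarith
      · intro i hi hmem
        simp only [Set.mem_Ico] at hmem
        obtain ⟨k, m, h, hk, hk1⟩ := hrot (2 + i) (by linarith) (by omega)
        refine contra₁ i hi k hk1 (by omega) (-m) ?_
        rw [abs_lt]; push_cast; constructor <;> linarith
    have hd := hX.le_abs_succ_sub hηξ hb hbc hηcξ (by linarith) (1 + j)
    rw [show 1 + (j + 1) = 1 + j + 1 by ring, show Y (1 + j + 1) = X (1 + j) + δ by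
      rw [← key]; congr 1; ring]
    have := abs_sub_abs_le_abs_sub (X (1 + j + 1) - X (1 + j)) δ
    rw [abs_of_pos hδ0] at this
    rw [show X (1 + j) + δ - X (1 + j + 1) = -(X (1 + j + 1) - X (1 + j) - δ) by ring, abs_neg]
    linarith

/-- Close points in different intervals lie in adjacent ones, whose displacements differ by `b + ξ`
or `1`, at least `4η`. Their images would be far apart, so both points undergo the same translation.
-/
theorem sub_eq_of_close (hX : IsIETOrbit ξ b c X) (hY : IsIETOrbit ξ b c Y)
    (hbc : b + c = 1) (hη0 : 0 < η) (hηξ : 2 * η ≤ ξ)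
    (hηb : 2 * η ≤ b) (hηc : 2 * η ≤ c) {s : ℕ} (h : |Y s - X s| < η)
    (h' : |Y (s + 1) - X (s + 1)| < η) : Y (s + 1) - X (s + 1) = Y s - X s := by
  have hb : 0 < b := by linarith
  rw [abs_lt] at h h'
  rcases lt_or_ge (X s) ξ with hA | hA
  · rw [hX.succ_of_lt hbc hA] at h' ⊢
    rcases lt_or_ge (Y s) ξ with hA' | hA'
    · rw [hY.succ_of_lt hbc hA']; ring
    · rw [hY.succ_of_mem hA' (by linarith)] at h'
      linarith
  rcases lt_or_ge (X s) (ξ + b) with hB | hB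
  · rw [hX.succ_of_mem hA hB] at h' ⊢
    rcases lt_or_ge (Y s) ξ with hA' | hA'
    · rw [hY.succ_of_lt hbc hA'] at h'
      linarith
    rcases lt_or_ge (Y s) (ξ + b) with hB' | hB'
    · rw [hY.succ_of_mem hA' hB']; ring
    · rw [hY.succ_of_le hb hB'] at h'
      linarith
  · rw [hX.succ_of_le hb hB] at h' ⊢
    rcases lt_or_ge (Y s) (ξ + b) with hB' | hB'
    · rw [hY.succ_of_mem (by linarith) hB'] at h'
      linarith
    · rw [hY.succ_of_le hb hB']; ring

theorem sub_eq_of_close_of_le (hX : IsIETOrbit ξ b c X) (hY : IsIETOrbit ξ b c Y)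
    (hbc : b + c = 1) (hη0 : 0 < η) (hηξ : 2 * η ≤ ξ)
    (hηb : 2 * η ≤ b) (hηc : 2 * η ≤ c) {L : ℕ} (h : ∀ s ≤ L, |Y s - X s| < η) :
    ∀ s ≤ L, Y s - X s = Y 0 - X 0 := by
  intro s hs
  induction s with
  | zero => rfl
  | succ s ih =>
    rw [sub_eq_of_close hX hY hbc hη0 hηξ hηb hηc (h s (by omega)) (h _ hs), ih (by omega)]

/-- A pair of orbits at distance `δ` is separated within a time of order `1 / δ`. -/
theorem length_mul_le_of_close (hX : IsIETOrbit ξ b c X) (hY : IsIETOrbit ξ b c Y)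
    (hξ1 : ξ < 1) (hbc : b + c = 1) (hα : ∃ e : ℤ, α = c - ξ + e) (hη0 : 0 < η) (hηξ : 2 * η ≤ ξ)
    (hηb : 2 * η ≤ b) (hηc : 2 * η ≤ c) {C : ℝ}
    (hC : ∀ x y δ : ℝ, 0 < δ → δ ≤ 1 →
      ∃ (i : ℕ) (m : ℤ), (i : ℝ) ≤ C / δ ∧ x + i * α + m ∈ Set.Ico (y - δ) y)
    (hlt : X 0 < Y 0) {L : ℕ} (h : ∀ s ≤ L, |Y s - X s| < η) :
    (L + 1) * (Y 0 - X 0) ≤ 2 * C + 1 := by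
  have hb : 0 < b := by linarith
  have hconst := sub_eq_of_close_of_le hX hY hbc hη0 hηξ hηb hηc h
  set δ := Y 0 - X 0 with hδ
  have hδ0 : 0 < δ := sub_pos.2 hlt
  have hδη : δ < η := by
    have h0 := h 0 (by omega)
    rwa [← hδ, abs_of_pos hδ0] at h0
  obtain ⟨i, m, hi, hm₁, hm₂⟩ := hC (X 0) ξ δ hδ0 (by linarith)
  obtain ⟨s, m', hs, hsm⟩ := hX.exists_eq_add_mul hξ1 hb hbc hα i
  suffices hL : L ≤ s by
    have h₁ : (L : ℝ) ≤ 2 * i := by exact_mod_cast hL.trans hs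
    rw [le_div_iff₀ hδ0] at hi
    nlinarith
  by_contra! hsL
  have hs₀ := hX.mem s
  have hs₁ := hY.mem s
  have hsδ := hconst s hsL.le
  have hXs : X s = (X 0 + i * α + m) + ((m' - m : ℤ) : ℝ) := by rw [hsm]; push_cast; ring
  have hd₁ : (-1 : ℝ) < ((m' - m : ℤ) : ℝ) := by linarith [hs₀.1]
  have hd₂ : ((m' - m : ℤ) : ℝ) < 2 := by linarith [hs₀.2]
  have hd₁' : -1 < m' - m := by exact_mod_cast hd₁
  have hd₂' : m' - m < 2 := by exact_mod_cast hd₂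
  -- The hit is known only modulo `1`. Either `X s` is just below `ξ` and `Y s` is across the
  -- discontinuity, or `X s` is just below `1 + ξ` and `Y s` would leave the domain.
  have hd : m' - m = 0 ∨ m' - m = 1 := by omega
  rcases hd with hd | hd
  · rw [hd, Int.cast_zero, add_zero] at hXs
    have hXξ : X s < ξ := by linarith
    have hYξ : ξ ≤ Y s := by linarith
    have h₁ := hX.succ_of_lt hbc hXξ
    have h₂ := hY.succ_of_mem hYξ (by linarith)
    have h₃ := hconst (s + 1) hsL
    linarith
  · rw [hd, Int.cast_one] at hXs
    linarith [hs₁.2]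

end IsIETOrbit

/-- If every run of good times is followed by a bad run of comparable length and bad times are
rare, then there is a single good run that fills most of the time interval. -/
theorem exists_long_run {p : ℕ → Prop} [DecidablePred p] {K : ℕ} (hK : 0 < K)
    (h : ∀ t r, t < r → (∀ s, t ≤ s → s < r → ¬p s) → p r → ∀ j, K * j ≤ r - t → p (r + j))
    (n t : ℕ) (ht : t ≤ n) :
    ∃ a r, t ≤ a ∧ a ≤ r ∧ r ≤ n ∧ (∀ s, a ≤ s → s < r → ¬p s) ∧
      n + a ≤ t + r + (K + 1) * ((Finset.Ico t n).filter p).card := by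
  induction hd : n - t using Nat.strong_induction_on generalizing t with
  | _ d ih =>
  subst hd
  rcases ht.eq_or_lt with rfl | ht
  · exact ⟨t, t, le_rfl, le_rfl, le_rfl, fun s h₁ h₂ => by omega, by omega⟩
  have hsplit : ∀ u, t ≤ u → u ≤ n → ((Finset.Ico t n).filter p).card =
      ((Finset.Ico t u).filter p).card + ((Finset.Ico u n).filter p).card := fun u h₁ h₂ => by
    rw [← Finset.Ico_union_Ico_eq_Ico h₁ h₂, Finset.filter_union, Finset.card_union_of_disjoint]
    exact Finset.disjoint_filter_filter (Finset.Ico_disjoint_Ico_consecutive t u n)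
  have hall : ∀ u v, (∀ s, u ≤ s → s < v → p s) → ((Finset.Ico u v).filter p).card = v - u :=
    fun u v huv => by
      rw [Finset.filter_true_of_mem fun s hs => huv s (Finset.mem_Ico.1 hs).1
        (Finset.mem_Ico.1 hs).2, Nat.card_Ico]
  by_cases hrun : ∀ s, t ≤ s → s < n → ¬p s
  · exact ⟨t, n, le_rfl, ht.le, le_rfl, hrun, by omega⟩
  have hrun' : ∃ s, t ≤ s ∧ s < n ∧ p s := by push Not at hrun; exact hrun
  obtain ⟨r, ⟨htr, hrn, hpr⟩, hmin⟩ : ∃ r, (t ≤ r ∧ r < n ∧ p r) ∧ ∀ s, t ≤ s → s < r → ¬p s :=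
    ⟨Nat.find hrun', Nat.find_spec hrun', fun s h₁ h₂ h₃ =>
      Nat.find_min hrun' h₂ ⟨h₁, h₂.trans (Nat.find_spec hrun').2.1, h₃⟩⟩
  -- The good run `[t, r)` and the `l` bad times after it span at most `(K + 1) * l`, which is
  -- charged to those bad times. If they reach `n`, the run `[t, r)` itself is the answer; otherwise
  -- the argument restarts at `r + l`.
  obtain ⟨l, hl0, hlK, hbad⟩ : ∃ l, 0 < l ∧ r - t ≤ K * l ∧ ∀ s, r ≤ s → s < r + l → s < n → p s := by
    rcases htr.eq_or_lt with rfl | htr'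
    · refine ⟨1, one_pos, by omega, fun s h₁ h₂ _ => ?_⟩
      rwa [show s = t by omega]
    · refine ⟨(r - t) / K + 1, Nat.succ_pos _, ?_, fun s h₁ h₂ _ => ?_⟩
      · exact (Nat.lt_mul_div_succ (r - t) hK).le
      · have := h t r htr' hmin hpr (s - r)
          ((Nat.mul_le_mul_left K (by omega)).trans (Nat.mul_div_le (r - t) K))
        rwa [show r + (s - r) = s by omega] at this
  rcases le_or_gt n (r + l) with hrl | hrl
  · refine ⟨t, r, le_rfl, htr, hrn.le, hmin, ?_⟩
    rw [hsplit r htr hrn.le, hall r n fun s h₁ h₂ => hbad s h₁ (by omega) h₂]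
    have : _ ≤ (K + 1) * (((Finset.Ico t r).filter p).card + (n - r)) :=
      Nat.le_mul_of_pos_left _ (Nat.succ_pos K)
    omega
  · obtain ⟨a, r', h₁, h₂, h₃, h₄, h₅⟩ := ih (n - (r + l)) (by omega) (r + l) hrl.le rfl
    refine ⟨a, r', by omega, h₂, h₃, h₄, ?_⟩
    rw [hsplit (r + l) (by omega) hrl.le]
    have h₆ : l ≤ ((Finset.Ico t (r + l)).filter p).card := by
      calc l = ((Finset.Ico r (r + l)).filter p).card := by
            rw [hall r (r + l) fun s h₁ h₂ => hbad s h₁ h₂ (by omega)]; omega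
        _ ≤ _ := Finset.card_le_card (Finset.filter_subset_filter _
            (Finset.Ico_subset_Ico_left htr))
    have h₇ := Nat.mul_le_mul_left (K + 1) h₆
    rw [Nat.mul_add]
    rw [Nat.add_mul K 1 l] at h₇
    omega

end IETOrbit


/-- Two orbits which are close at most of the times before `n` are at distance `O(1 / n)` at the
middle time. -/
theorem exists_abs_sub_midpoint_le {ξ b c α : ℝ} (hξ0 : 0 < ξ) (hξ1 : ξ < 1) (hb : 0 < b)
    (hc : 0 < c) (hbc : b + c = 1) (hcξ : c ≠ ξ) (hα : ∃ e : ℤ, α = c - ξ + e)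
    (hbad : BadlyApproximable α) (hsep : ξ ∈ wellSeparated α) :
    ∃ η > 0, ∃ ε₀ > 0, ∃ C > 0, ∀ X Y : ℕ → ℝ, IsIETOrbit ξ b c X → IsIETOrbit ξ b c Y →
      ∀ n : ℕ, 0 < n → (((Finset.range n).filter fun s => η ≤ |Y s - X s|).card : ℝ) ≤ ε₀ * n →
        |Y (n / 2) - X (n / 2)| ≤ C / n := by
  obtain ⟨κ₁, hκ₁, h₁⟩ := hbad.exists_le_mul_abs_sub
  obtain ⟨κ₂, hκ₂, h₂⟩ := exists_le_mul_abs_sub_of_mem_wellSeparated hbad hsep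
  obtain ⟨C, hC0, hC⟩ := hbad.exists_orbit_mem_Ico
  obtain ⟨η, hη0, hηξ, hηb, hηc, hηcξ⟩ : ∃ η : ℝ, 0 < η ∧ 2 * η ≤ ξ ∧ 2 * η ≤ b ∧ 2 * η ≤ c ∧
      2 * η ≤ |c - ξ| := by
    have hcξ' : 0 < |c - ξ| := abs_pos.2 (sub_ne_zero.2 hcξ)
    refine ⟨min (min ξ b) (min c |c - ξ|) / 2, by positivity, ?_, ?_, ?_, ?_⟩ <;>
      rw [mul_div_cancel₀ _ two_ne_zero] <;> simp
  set κ := min κ₁ κ₂ with hκ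
  have hκ0 : 0 < κ := lt_min hκ₁ hκ₂
  set D := 2 * C + 1 with hD
  -- A good run of length `R` has `δ ≤ D / R`. The factor `2` absorbs the passage from `j + 1` to `j
  -- + 2 ≤ 2 (j + 1)` when the bad time is estimated.
  obtain ⟨K, hK⟩ := exists_nat_gt (2 * D / κ)
  have hK0 : 0 < K := by
    have : (0 : ℝ) < K := lt_trans (by positivity) hK
    exact_mod_cast this
  have hlen : ∀ X Y : ℕ → ℝ, IsIETOrbit ξ b c X → IsIETOrbit ξ b c Y → ∀ t r, t < r →
      (∀ s, t ≤ s → s < r → |Y s - X s| < η) →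
      (∀ s, t ≤ s → s < r → Y s - X s = Y t - X t) ∧ ((r : ℝ) - t) * |Y t - X t| ≤ D := by
    intro X Y hX hY t r htr hgood
    obtain ⟨L, rfl⟩ : ∃ L, r = t + L + 1 := ⟨r - t - 1, by omega⟩
    have hg : ∀ s ≤ L, |Y (t + s) - X (t + s)| < η := fun s hs => hgood _ (by omega) (by omega)
    have hg' : ∀ s ≤ L, |X (t + s) - Y (t + s)| < η := fun s hs => by
      rw [abs_sub_comm]; exact hg s hs
    refine ⟨fun s hs₁ hs₂ => ?_, ?_⟩
    · have := (hX.shift t).sub_eq_of_close_of_le (hY.shift t) hbc hη0 hηξ hηb hηc hg (s - t)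
        (by omega)
      simpa [Nat.add_sub_cancel' hs₁] using this
    · rw [show ((t + L + 1 : ℕ) : ℝ) - t = L + 1 by push_cast; ring]
      rcases lt_trichotomy (X t) (Y t) with h | h | h
      · rw [abs_of_pos (sub_pos.2 h)]
        exact (hX.shift t).length_mul_le_of_close (hY.shift t) hξ1 hbc hα hη0 hηξ hηb hηc hC h hg
      · simp only [h, sub_self, abs_zero, mul_zero]; positivity
      · rw [abs_sub_comm, abs_of_pos (sub_pos.2 h)]
        exact (hY.shift t).length_mul_le_of_close (hX.shift t) hξ1 hbc hα hη0 hηξ hηb hηc hC h hg'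
  have hafter : ∀ X Y : ℕ → ℝ, IsIETOrbit ξ b c X → IsIETOrbit ξ b c Y → ∀ u,
      |Y u - X u| < η → η ≤ |Y (u + 1) - X (u + 1)| → ∀ j : ℕ, (j + 1) * |Y u - X u| ≤ κ →
      η ≤ |Y (u + 1 + j) - X (u + 1 + j)| := by
    intro X Y hX hY u hu hu' j hj
    have h₁' : ∀ k : ℕ, 1 ≤ k → ∀ p : ℤ, κ ≤ k * |k * α - p| :=
      fun k hk p => (min_le_left _ _).trans (h₁ k hk p)
    have h₂' : ∀ j p : ℤ, κ ≤ (|j| + 1) * |ξ - j * α - p| :=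
      fun j p => (min_le_right _ _).trans (h₂ j p)
    rw [add_assoc]
    rcases lt_trichotomy (X u) (Y u) with h | h | h
    · rw [abs_of_pos (sub_pos.2 h)] at hu hj
      exact (hX.shift u).le_abs_sub_after_crossing (hY.shift u) hbc hα hη0 hηξ hηb hηc hηcξ h₁' h₂'
        h hu hu' j hj
    · rw [hX.succ, hY.succ, h, sub_self, abs_zero] at hu'
      linarith
    · rw [abs_sub_comm, abs_of_pos (sub_pos.2 h)] at hu hj
      rw [abs_sub_comm] at hu' ⊢
      exact (hY.shift u).le_abs_sub_after_crossing (hX.shift u) hbc hα hη0 hηξ hηb hηc hηcξ h₁' h₂'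
        h hu hu' j hj
  -- With this proportion of bad times the long run has length at least `3n/4`. Hence it contains `n
  -- / 2`, and its distance is at most `2D / n`.
  refine ⟨η, hη0, 1 / (4 * (K + 1)), by positivity, 2 * D, by positivity,
    fun X Y hX hY n hn hcard => ?_⟩
  obtain ⟨a, r, -, har, hrn, hgood, hcount⟩ := exists_long_run (p := fun s => η ≤ |Y s - X s|) hK0
    (fun t r htr hgood hr j hj => by
      rcases j with _ | j
      · exact hr
      simp only [not_le] at hgood
      obtain ⟨hconst, hbound⟩ := hlen X Y hX hY t r htr hgood
      obtain ⟨u, rfl⟩ : ∃ u, r = u + 1 := ⟨r - 1, by omega⟩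
      refine hafter X Y hX hY u (hgood u (by omega) (by omega)) hr _ ?_
      rw [hconst u (by omega) (by omega)]
      have hj' : (K : ℝ) * (j + 1) ≤ (u + 1 : ℕ) - t := by
        rw [← Nat.cast_sub htr.le]; exact_mod_cast hj
      have hδ := abs_nonneg (Y t - X t)
      rw [div_lt_iff₀ hκ0] at hK
      have h₃ : K * (j + 1) * |Y t - X t| ≤ D :=
        (mul_le_mul_of_nonneg_right hj' hδ).trans hbound
      have hK' : (0 : ℝ) < K := by exact_mod_cast hK0
      refine le_of_mul_le_mul_left ?_ hK'
      push_cast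
      nlinarith [mul_nonneg (mul_nonneg hK'.le (Nat.cast_nonneg j : (0 : ℝ) ≤ j)) hδ])
    n 0 (Nat.zero_le n)
  simp only [not_le] at hgood
  rw [Nat.Ico_zero_eq_range] at hcount
  have hcount' : 4 * ((K + 1) * ((Finset.range n).filter fun s => η ≤ |Y s - X s|).card) ≤ n := by
    rw [one_div, ← div_eq_inv_mul, le_div_iff₀ (by positivity)] at hcard
    have : (4 * ((K + 1) * ((Finset.range n).filter fun s => η ≤ |Y s - X s|).card) : ℝ) ≤ n := by
      linarith
    exact_mod_cast this
  obtain ⟨hconst, hbound⟩ := hlen X Y hX hY a r (by omega) hgood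
  rw [hconst (n / 2) (by omega) (by omega), le_div_iff₀ (by positivity)]
  have hra : (n : ℝ) + 2 * a ≤ 2 * r := by
    have : n + 2 * a ≤ 2 * r := by omega
    exact_mod_cast this
  nlinarith [abs_nonneg (Y a - X a)]

/-! ### Invariance of the Lebesgue measure -/

section Invariance

variable {ξ b c : ℝ} (hξ0 : 0 < ξ) (hb : 0 < b) (hc : 0 < c)

theorem isIETOrbit_threeIET (x : Set.Ico (0 : ℝ) (ξ + b + c)) :
    IsIETOrbit ξ b c fun s => ((threeIET ξ b c hξ0 hb hc)^[s] x : ℝ) :=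
  ⟨fun s => ((threeIET ξ b c hξ0 hb hc)^[s] x).2, fun s => by
    rw [Function.iterate_succ_apply']; rfl⟩

theorem measurable_threeIET : Measurable (threeIET ξ b c hξ0 hb hc) := by
  refine Measurable.subtype_mk ?_
  refine Measurable.ite (measurableSet_lt measurable_subtype_coe measurable_const) (by fun_prop) ?_
  exact Measurable.ite (measurableSet_lt measurable_subtype_coe measurable_const) (by fun_prop)
    (by fun_prop)

theorem normalizedLebesgue_apply (L : ℝ) (S : Set (Set.Ico (0 : ℝ) L)) :
    normalizedLebesgue L S = (ENNReal.ofReal L)⁻¹ * volume (Subtype.val '' S) := by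
  rw [normalizedLebesgue, Measure.smul_apply, smul_eq_mul, comap_subtype_coe_apply measurableSet_Ico]

/-- The three branches are translations with disjoint images. The inequality is all that either
bound requires of invariance. -/
theorem normalizedLebesgue_preimage_threeIET_le {S : Set (Set.Ico (0 : ℝ) (ξ + b + c))}
    (hS : MeasurableSet S) :
    normalizedLebesgue (ξ + b + c) (threeIET ξ b c hξ0 hb hc ⁻¹' S) ≤
      normalizedLebesgue (ξ + b + c) S := by
  rw [normalizedLebesgue_apply, normalizedLebesgue_apply]
  refine mul_le_mul_right ?_ _
  have hS' : MeasurableSet (Subtype.val '' S) :=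
    (MeasurableEmbedding.subtype_coe measurableSet_Ico).measurableSet_image.2 hS
  set T : Set ℝ := Subtype.val '' S
  have hsub : Subtype.val '' (threeIET ξ b c hξ0 hb hc ⁻¹' S) ⊆
      ((fun x => x + (b + c)) ⁻¹' (T ∩ Set.Ici (b + c)) ∪
        (fun x => x + (c - ξ)) ⁻¹' (T ∩ Set.Ico c (b + c))) ∪
        (fun x => x + (-ξ - b)) ⁻¹' (T ∩ Set.Iio c) := by
    rintro _ ⟨x, hx, rfl⟩
    have hx' : ((threeIET ξ b c hξ0 hb hc x : ℝ)) ∈ T := ⟨_, hx, rfl⟩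
    have h0 := x.2.1
    have h1 := x.2.2
    change (if (x : ℝ) < ξ then (x : ℝ) + b + c else if (x : ℝ) < ξ + b then (x : ℝ) + c - ξ else
      (x : ℝ) - ξ - b) ∈ T at hx'
    split_ifs at hx' with h h'
    · refine Or.inl (Or.inl ⟨by simpa only [add_assoc] using hx', ?_⟩)
      simp only [Set.mem_Ici]; linarith
    · refine Or.inl (Or.inr ⟨by simpa only [add_sub_assoc] using hx', ?_⟩)
      simp only [Set.mem_Ico]; constructor <;> linarith
    · refine Or.inr ⟨by convert hx' using 1; ring, ?_⟩
      simp only [Set.mem_Iio]; linarith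
  calc volume (Subtype.val '' (threeIET ξ b c hξ0 hb hc ⁻¹' S))
      ≤ volume (T ∩ Set.Ici (b + c)) + volume (T ∩ Set.Ico c (b + c)) + volume (T ∩ Set.Iio c) := by
        refine (measure_mono hsub).trans ((measure_union_le _ _).trans ?_)
        rw [measure_preimage_add_right]
        gcongr
        refine (measure_union_le _ _).trans ?_
        rw [measure_preimage_add_right, measure_preimage_add_right]
    _ = volume ((T ∩ Set.Ici (b + c) ∪ T ∩ Set.Ico c (b + c)) ∪ T ∩ Set.Iio c) := by
        rw [measure_union _ (hS'.inter measurableSet_Iio),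
          measure_union _ (hS'.inter measurableSet_Ico)]
        · exact Set.disjoint_left.2 fun x h₁ h₂ => not_lt.2 h₁.2 h₂.2.2
        · refine Set.disjoint_left.2 fun x h₁ h₂ => ?_
          have h₃ : x < c := h₂.2
          rcases h₁ with h₁ | h₁
          · have : b + c ≤ x := h₁.2
            linarith
          · exact not_lt.2 h₁.2.1 h₃
    _ ≤ volume T := measure_mono (Set.union_subset (Set.union_subset Set.inter_subset_left
        Set.inter_subset_left) Set.inter_subset_left)

theorem normalizedLebesgue_preimage_iterate_le (s : ℕ) {S : Set (Set.Ico (0 : ℝ) (ξ + b + c))}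
    (hS : MeasurableSet S) :
    normalizedLebesgue (ξ + b + c) ((threeIET ξ b c hξ0 hb hc)^[s] ⁻¹' S) ≤
      normalizedLebesgue (ξ + b + c) S := by
  induction s with
  | zero => rfl
  | succ s ih =>
    rw [Function.iterate_succ, Set.preimage_comp]
    exact (normalizedLebesgue_preimage_threeIET_le hξ0 hb hc
      ((measurable_threeIET hξ0 hb hc).iterate s hS)).trans ih

end Invariance

/-! ### The lower bound -/

/-- The labelling of `[0, L)`, `L ≤ 2`, by the cells `[j / N, (j + 1) / N)`. -/
noncomputable def cellLabel (L : ℝ) (N : ℕ) (x : Set.Ico (0 : ℝ) L) : Fin (2 * N + 1) :=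
  Fin.ofNat (2 * N + 1) ⌊N * (x : ℝ)⌋₊

theorem measurable_cellLabel (L : ℝ) (N : ℕ) : Measurable (cellLabel L N) :=
  (measurable_from_top (f := fun n : ℕ => Fin.ofNat (2 * N + 1) n)).comp
    (Nat.measurable_floor.comp (by fun_prop))

/-- `L ≤ 2` keeps the floor below the modulus `2 * N + 1`, so `Fin.ofNat` does not wrap around. -/
theorem cellLabel_eq_iff {L : ℝ} (hL : L ≤ 2) {N : ℕ} (x y : Set.Ico (0 : ℝ) L) :
    cellLabel L N x = cellLabel L N y ↔ ⌊N * (x : ℝ)⌋₊ = ⌊N * (y : ℝ)⌋₊ := by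
  have h : ∀ x : Set.Ico (0 : ℝ) L, ⌊N * (x : ℝ)⌋₊ < 2 * N + 1 := fun x => by
    have hx := x.2.2
    have h0 := x.2.1
    rw [Nat.floor_lt (by positivity)]
    push_cast
    nlinarith [(Nat.cast_nonneg N : (0 : ℝ) ≤ N)]
  rw [cellLabel, cellLabel, Fin.ext_iff, Fin.val_ofNat, Fin.val_ofNat, Nat.mod_eq_of_lt (h x),
    Nat.mod_eq_of_lt (h y)]

theorem abs_sub_lt_of_floor_eq {N : ℕ} (hN : 0 < N) {x y : ℝ} (hx : 0 ≤ x) (hy : 0 ≤ y)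
    (h : ⌊N * x⌋₊ = ⌊N * y⌋₊) : |y - x| < 1 / N := by
  have hN' : (0 : ℝ) < N := by exact_mod_cast hN
  have h₁ := Nat.floor_le (show 0 ≤ N * x by positivity)
  have h₂ := Nat.lt_floor_add_one (N * x)
  have h₃ := Nat.floor_le (show 0 ≤ N * y by positivity)
  have h₄ := Nat.lt_floor_add_one (N * y)
  rw [h] at h₁ h₂
  rw [abs_lt, neg_lt, lt_div_iff₀ hN', lt_div_iff₀ hN']
  constructor <;> nlinarith

theorem card_filter_ne {X : Type*} {k : ℕ} (f : X → X) (P : X → Fin k) {n : ℕ} (hn : 0 < n)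
    (x y : X) : (((Finset.range n).filter fun s => P (f^[s] x) ≠ P (f^[s] y)).card : ℝ) =
      orbitHammingDist f P n x y * n := by
  have h := Finset.card_filter_add_card_filter_not (s := Finset.range n)
    fun s => P (f^[s] x) = P (f^[s] y)
  rw [Finset.card_range] at h
  have h' : ((((Finset.range n).filter fun s => P (f^[s] x) = P (f^[s] y)).card : ℕ) : ℝ) +
    (((Finset.range n).filter fun s => ¬P (f^[s] x) = P (f^[s] y)).card : ℕ) = n := by
    exact_mod_cast h
  have hn' : (n : ℝ) ≠ 0 := by positivity
  rw [orbitHammingDist, sub_mul, div_mul_cancel₀ _ hn', one_mul]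
  linarith

theorem normalizedLebesgue_abs_sub_le {L : ℝ} (hL : 1 ≤ L) (z r : ℝ) :
    normalizedLebesgue L {x | |(x : ℝ) - z| ≤ r} ≤ ENNReal.ofReal (2 * r) := by
  rw [normalizedLebesgue_apply]
  have h₁ : (ENNReal.ofReal L)⁻¹ ≤ 1 := ENNReal.inv_le_one.2 (by simpa using hL)
  have h₂ : volume (Subtype.val '' {x : Set.Ico (0 : ℝ) L | |(x : ℝ) - z| ≤ r}) ≤
      ENNReal.ofReal (2 * r) := by
    rw [← Real.volume_closedBall z]
    refine measure_mono ?_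
    rintro _ ⟨x, hx, rfl⟩
    simpa [Real.dist_eq] using hx
  simpa using mul_le_mul' h₁ h₂

/-- If Hamming balls have measure `O(1 / n)`, then the critical exponent is at least `1`. -/
theorem one_le_criticalExponent {X : Type*} [MeasurableSpace X] {μ : Measure X}
    [IsProbabilityMeasure μ] {f : X → X} {k : ℕ} {P : X → Fin k} {ε C : ℝ} (hε : ε ≤ 1 / 2)
    (hC : 0 < C)
    (h : ∀ n : ℕ, 0 < n → ∀ x, μ.real (hammingBall f P n x ε) ≤ C / n) :
    1 ≤ criticalExponent polynomialScale μ f P ε := by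
  have hcover : ∀ n : ℕ, 0 < n →
      ENNReal.ofReal (1 / (2 * C)) * n ≤ (coverNumber μ f P ε n : ℝ≥0∞) := by
    intro n hn
    have hn' : (0 : ℝ) < n := by exact_mod_cast hn
    simp only [coverNumber, ENat.toENNReal_iInf]
    refine le_iInf₂ fun F hF => ?_
    have h₁ : μ.real (⋃ x ∈ F, hammingBall f P n x ε) ≤ F.card * (C / n) :=
      (measureReal_biUnion_finset_le _ _).trans
        ((Finset.sum_le_card_nsmul _ _ _ fun x _ => h n hn x).trans_eq (nsmul_eq_mul _ _))
    have h₂ : 1 / (2 * C) * n ≤ F.card := by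
      have h₃ : 1 / 2 ≤ F.card * (C / n) := by linarith
      rw [mul_div_assoc', le_div_iff₀ hn'] at h₃
      rw [one_div_mul_eq_div, div_le_iff₀ (by positivity)]
      linarith
    rw [ENat.toENNReal_coe, ← ENNReal.ofReal_natCast, ← ENNReal.ofReal_natCast,
      ← ENNReal.ofReal_mul (by positivity)]
    exact ENNReal.ofReal_le_ofReal h₂
  refine le_iSup₂_of_le (1 : ℝ≥0) ?_ (by simp)
  refine lt_of_lt_of_le (b := ENNReal.ofReal (1 / (2 * C))) (by simpa using hC) ?_
  refine le_limsup_of_frequently_le' (Eventually.frequently ?_)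
  filter_upwards [eventually_gt_atTop 0] with n hn
  rw [polynomialScale, NNReal.coe_one, Real.rpow_one, ENNReal.ofReal_natCast,
    ENNReal.le_div_iff_mul_le (by simp [hn.ne']) (by simp)]
  exact hcover n hn

theorem one_le_metricSlowEntropy_threeIET {ξ b c α : ℝ} (hξ0 : 0 < ξ) (hξ1 : ξ < 1) (hb : 0 < b)
    (hc : 0 < c) (hbc : b + c = 1) (hcξ : c ≠ ξ) (hα : ∃ e : ℤ, α = c - ξ + e)
    (hbad : BadlyApproximable α) (hsep : ξ ∈ wellSeparated α) :
    1 ≤ metricSlowEntropy polynomialScale (normalizedLebesgue (ξ + b + c))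
      (threeIET ξ b c hξ0 hb hc) := by
  obtain ⟨η, hη, ε₀, hε₀, C, hC, h⟩ :=
    exists_abs_sub_midpoint_le hξ0 hξ1 hb hc hbc hcξ hα hbad hsep
  have := isProbabilityMeasure_normalizedLebesgue (L := ξ + b + c) (by positivity)
  -- Cells shorter than `η` give different labels to points at distance at least `η`, so a far time
  -- is always a Hamming error.
  obtain ⟨N, hN⟩ := exists_nat_gt (1 / η)
  have hN0 : 0 < N := by
    have : (0 : ℝ) < N := lt_trans (by positivity) hN
    exact_mod_cast this
  refine le_iSup_of_le _ (le_iSup₂_of_le (cellLabel (ξ + b + c) N) (measurable_cellLabel _ _) ?_)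
  refine le_limsup_of_frequently_le' (Eventually.frequently ?_)
  have hε : 0 < min ε₀ (1 / 2) := by positivity
  filter_upwards [Ioo_mem_nhdsGT hε] with ε hε
  refine one_le_criticalExponent (C := 2 * C) (hε.2.le.trans (min_le_right _ _)) (by positivity)
    fun n hn x => ?_
  set f := threeIET ξ b c hξ0 hb hc with hf
  have hn' : (0 : ℝ) < n := by exact_mod_cast hn
  have hsub : hammingBall f (cellLabel (ξ + b + c) N) n x ε ⊆
      f^[n / 2] ⁻¹' {y | |(y : ℝ) - f^[n / 2] x| ≤ C / n} := by
    intro y hy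
    refine h _ _ (isIETOrbit_threeIET hξ0 hb hc x) (isIETOrbit_threeIET hξ0 hb hc y) n hn ?_
    have hy' : orbitHammingDist f (cellLabel (ξ + b + c) N) n x y ≤ ε₀ :=
      (le_of_lt hy).trans (hε.2.le.trans (min_le_left _ _))
    refine le_trans ?_ (mul_le_mul_of_nonneg_right hy' hn'.le)
    rw [← card_filter_ne f _ hn, Nat.cast_le]
    refine Finset.card_le_card (Finset.monotone_filter_right _ fun s _ hs heq => ?_)
    rw [cellLabel_eq_iff (by linarith)] at heq
    have h₁ := abs_sub_lt_of_floor_eq hN0 (f^[s] x).2.1 (f^[s] y).2.1 heq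
    have h₂ : 1 / (N : ℝ) < η := by
      rw [div_lt_iff₀ hη] at hN
      rw [div_lt_iff₀ (by exact_mod_cast hN0)]
      linarith
    exact absurd (h₁.trans h₂) (not_lt.2 hs)
  have hmeas : MeasurableSet {y : Set.Ico (0 : ℝ) (ξ + b + c) | |(y : ℝ) - f^[n / 2] x| ≤ C / n} :=
    measurableSet_le (by fun_prop) measurable_const
  refine ENNReal.toReal_le_of_le_ofReal (by positivity) ?_
  refine (measure_mono hsub).trans
    ((normalizedLebesgue_preimage_iterate_le hξ0 hb hc _ hmeas).trans ?_)
  rw [mul_div_assoc]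
  exact normalizedLebesgue_abs_sub_le (by linarith) _ _


/-! ### The upper bound -/

/-- Every finite measurable partition of `[0, L)` agrees, up to small measure, with one into unions
of cells `[j / N, (j + 1) / N)`. -/
theorem exists_cell_approximation {L : ℝ} (hL : 1 ≤ L) {k : ℕ} {P : Set.Ico (0 : ℝ) L → Fin k}
    (hP : Measurable P) {δ : ℝ} (hδ : 0 < δ) :
    ∃ (N : ℕ) (g : ℕ → Fin k), 0 < N ∧
      normalizedLebesgue L {x | P x ≠ g ⌊N * (x : ℝ)⌋₊} ≤ ENNReal.ofReal δ := by
  have hk : 0 < k := Fin.pos (P ⟨0, le_rfl, by linarith⟩)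
  set E : Fin k → Set ℝ := fun i => Subtype.val '' (P ⁻¹' {i}) with hE
  have hEm : ∀ i, MeasurableSet (E i) := fun i =>
    (MeasurableEmbedding.subtype_coe measurableSet_Ico).measurableSet_image.2
      (hP (measurableSet_singleton i))
  have hEfin : ∀ i, volume (E i) ≠ ∞ := fun i => by
    refine ne_top_of_le_ne_top (b := volume (Set.Ico 0 L)) (by simp) (measure_mono ?_)
    rintro _ ⟨x, -, rfl⟩
    exact x.2
  have hδk : ENNReal.ofReal (δ / k) ≠ 0 := by simpa using by positivity
  choose K hKE hK hKδ using fun i => (hEm i).exists_isCompact_sdiff_lt (hEfin i) hδk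
  have hKdisj : ∀ i j x, x ∈ K i → x ∈ K j → i = j := by
    intro i j x hi hj
    obtain ⟨y, hy, rfl⟩ := hKE i hi
    obtain ⟨z, hz, hzy⟩ := hKE j hj
    obtain rfl : z = y := Subtype.ext hzy
    exact hy.symm.trans hz
  -- The compact sets `K i` are disjoint. A Lebesgue number for the complements of the unions of the
  -- others is a radius at which a ball centred on one of them meets no other.
  obtain ⟨r, hr, hball⟩ := lebesgue_number_lemma_of_metric (c := fun i => (⋃ j ∈ {j | j ≠ i}, K j)ᶜ)
    (isCompact_iUnion hK)
    (fun i => ((Set.toFinite _).isClosed_biUnion fun j _ => (hK j).isClosed).isOpen_compl)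
    (fun x hx => by
      obtain ⟨i, hi⟩ := Set.mem_iUnion.1 hx
      refine Set.mem_iUnion.2 ⟨i, ?_⟩
      simp only [Set.mem_compl_iff, Set.mem_iUnion, not_exists]
      exact fun j hj hxj => hj (hKdisj j i x hxj hi))
  obtain ⟨N, hN⟩ := exists_nat_gt (1 / r)
  have hN0 : 0 < N := by
    have : (0 : ℝ) < N := lt_trans (by positivity) hN
    exact_mod_cast this
  have hNr : 1 / (N : ℝ) < r := by
    rw [div_lt_iff₀ hr] at hN
    rw [div_lt_iff₀ (by exact_mod_cast hN0)]
    linarith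
  classical
  -- As `1 / N < r`, a cell meets at most one `K i`, so the choice is forced; cells meeting none get
  -- the default label.
  let g : ℕ → Fin k := fun n =>
    if h : ∃ i, ∃ x ∈ K i, ⌊N * x⌋₊ = n then h.choose else ⟨0, hk⟩
  refine ⟨N, g, hN0, ?_⟩
  have hg : ∀ x : Set.Ico (0 : ℝ) L, (x : ℝ) ∈ K (P x) → P x = g ⌊N * (x : ℝ)⌋₊ := by
    intro x hx
    have hex : ∃ i, ∃ y ∈ K i, ⌊N * y⌋₊ = ⌊N * (x : ℝ)⌋₊ := ⟨P x, x, hx, rfl⟩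
    have hgx : g ⌊N * (x : ℝ)⌋₊ = hex.choose := dif_pos hex
    obtain ⟨y, hy, hxy⟩ := hex.choose_spec
    rw [← hgx] at hy
    have hy0 : 0 ≤ y := by
      obtain ⟨z, -, rfl⟩ := hKE _ hy
      exact z.2.1
    obtain ⟨j, hj⟩ := hball x (Set.mem_iUnion.2 ⟨_, hx⟩)
    have key : ∀ i, ∀ z ∈ Metric.ball (x : ℝ) r, z ∈ K i → i = j := fun i z hz hzi => by
      by_contra hne
      exact hj hz (Set.mem_biUnion (show i ∈ {i | i ≠ j} from hne) hzi)
    rw [key _ _ (Metric.mem_ball_self hr) hx]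
    refine (key _ y ?_ hy).symm
    rw [Metric.mem_ball, Real.dist_eq, abs_sub_comm]
    exact (abs_sub_lt_of_floor_eq hN0 hy0 x.2.1 hxy).trans hNr
  rw [normalizedLebesgue_apply]
  have h₁ : (ENNReal.ofReal L)⁻¹ ≤ 1 := ENNReal.inv_le_one.2 (by simpa using hL)
  have h₂ : volume (Subtype.val '' {x : Set.Ico (0 : ℝ) L | P x ≠ g ⌊N * (x : ℝ)⌋₊}) ≤
      ENNReal.ofReal δ := by
    calc _ ≤ volume (⋃ i, E i \ K i) := by
          refine measure_mono ?_
          rintro _ ⟨x, hx, rfl⟩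
          exact Set.mem_iUnion.2 ⟨P x, ⟨x, rfl, rfl⟩, fun hx' => hx (hg x hx')⟩
      _ ≤ ∑ i, volume (E i \ K i) := measure_iUnion_fintype_le _ _
      _ ≤ ∑ _i : Fin k, ENNReal.ofReal (δ / k) := Finset.sum_le_sum fun i _ => (hKδ i).le
      _ = ENNReal.ofReal δ := by
          have hk' : (k : ℝ) ≠ 0 := by positivity
          rw [Finset.sum_const, Finset.card_univ, Fintype.card_fin, nsmul_eq_mul,
            ← ENNReal.ofReal_natCast, ← ENNReal.ofReal_mul (by positivity),
            mul_div_cancel₀ _ hk']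
  simpa using mul_le_mul' h₁ h₂

/-! ### Linear growth of the number of cell itineraries -/

section Complexity

variable {ξ b c : ℝ} (hξ0 : 0 < ξ) (hb : 0 < b) (hc : 0 < c)

theorem injective_threeIET : Function.Injective (threeIET ξ b c hξ0 hb hc) := by
  rintro ⟨x, hx0, hx1⟩ ⟨y, hy0, hy1⟩ h
  simp only [threeIET, Subtype.mk.injEq] at h
  refine Subtype.ext (show x = y from ?_)
  split_ifs at h <;> linarith

/-- Two points which are not separated by any cut before time `n` move in parallel. -/
theorem iterate_sub_eq_of_not_cut {x y : Set.Ico (0 : ℝ) (ξ + b + c)} {n : ℕ}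
    (hcut : ∀ z, x < z → z ≤ y → ∀ s < n, ((threeIET ξ b c hξ0 hb hc)^[s] z : ℝ) ≠ ξ ∧
      ((threeIET ξ b c hξ0 hb hc)^[s] z : ℝ) ≠ ξ + b) :
    ∀ s ≤ n, ∀ z, x ≤ z → z ≤ y → ((threeIET ξ b c hξ0 hb hc)^[s] z : ℝ) =
      (threeIET ξ b c hξ0 hb hc)^[s] x + (z - x) := by
  set f := threeIET ξ b c hξ0 hb hc
  intro s hs
  induction s with
  | zero => intro z _ _; simp
  | succ s ih =>
    have ih' := ih (by omega)
    -- If `e` separated the images of `x` and `z`, parallel motion up to time `s` would make some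
    -- point between them land exactly on `e`.
    have hno : ∀ e : ℝ, (∀ z, x < z → z ≤ y → (f^[s] z : ℝ) ≠ e) →
        ∀ z, x ≤ z → z ≤ y → ((f^[s] x : ℝ) < e ↔ (f^[s] z : ℝ) < e) := by
      intro e he z hxz hzy
      have hxz' : (x : ℝ) ≤ z := hxz
      have hzy' : (z : ℝ) ≤ y := hzy
      have hz := ih' z hxz hzy
      refine ⟨fun h => ?_, fun h => by linarith⟩
      by_contra! hez
      have hw₁ : (x : ℝ) < x + (e - f^[s] x) := by linarith
      have hw₂ : (x : ℝ) + (e - f^[s] x) ≤ z := by linarith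
      let w : Set.Ico (0 : ℝ) (ξ + b + c) :=
        ⟨x + (e - f^[s] x), by linarith [x.2.1], by linarith [z.2.2]⟩
      have hwx : x < w := hw₁
      have hwz : w ≤ z := hw₂
      refine he w hwx (hwz.trans hzy) ?_
      rw [ih' w hwx.le (hwz.trans hzy)]
      simp [w]
    intro z hxz hzy
    have h := ih' z hxz hzy
    have h₁ := hno ξ (fun z h₁ h₂ => (hcut z h₁ h₂ s (by omega)).1) z hxz hzy
    have h₂ := hno (ξ + b) (fun z h₁ h₂ => (hcut z h₁ h₂ s (by omega)).2) z hxz hzy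
    rw [(isIETOrbit_threeIET hξ0 hb hc z).succ s, (isIETOrbit_threeIET hξ0 hb hc x).succ s]
    change (if (f^[s] z : ℝ) < ξ then _ else if (f^[s] z : ℝ) < ξ + b then _ else _) =
      (if (f^[s] x : ℝ) < ξ then (_ : ℝ) else if (f^[s] x : ℝ) < ξ + b then _ else _) + _
    simp only [h₁, h₂]
    split_ifs <;> linarith

/-- The number of itineraries of length `n` through the cells `[j / N, (j + 1) / N)` grows at most
linearly in `n`. -/
theorem exists_linear_coding (hξ1 : ξ < 1) (hbc : b + c = 1) {N : ℕ} (hN : 0 < N) :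
    ∃ E : ℕ, ∀ n : ℕ, ∃ code : Set.Ico (0 : ℝ) (ξ + b + c) → ℕ, (∀ x, code x ≤ E * n) ∧
      ∀ x y, code x = code y → ∀ s < n,
        ⌊N * ((threeIET ξ b c hξ0 hb hc)^[s] x : ℝ)⌋₊ =
          ⌊N * ((threeIET ξ b c hξ0 hb hc)^[s] y : ℝ)⌋₊ := by
  classical
  set f := threeIET ξ b c hξ0 hb hc
  let E : Finset ℝ := (Finset.range (2 * N + 1)).image (fun j : ℕ => (j : ℝ) / N) ∪ {ξ, ξ + b}
  have hinj : ∀ s, Function.Injective fun z : Set.Ico (0 : ℝ) (ξ + b + c) => (f^[s] z : ℝ) :=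
    fun s => Subtype.val_injective.comp ((injective_threeIET hξ0 hb hc).iterate s)
  refine ⟨E.card, fun n => ?_⟩
  let D : Finset (Set.Ico (0 : ℝ) (ξ + b + c)) := (Finset.range n).biUnion fun s =>
    E.preimage (fun z => (f^[s] z : ℝ)) (hinj s).injOn
  have hD : D.card ≤ E.card * n := by
    refine Finset.card_biUnion_le.trans ?_
    refine (Finset.sum_le_card_nsmul _ _ E.card fun s _ => ?_).trans (by simp [mul_comm])
    exact Finset.card_le_card_of_injOn (fun z => (f^[s] z : ℝ))
      (fun z hz => (Finset.mem_preimage (f := fun z => (f^[s] z : ℝ))).1 hz) (hinj s).injOn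
  -- The code of `x` counts the cuts up to `x`, so equal codes mean that no cut lies between the two
  -- points. By injectivity each endpoint contributes at most one cut per time.
  refine ⟨fun x => (D.filter (· ≤ x)).card,
    fun x => (Finset.card_le_card (Finset.filter_subset _ _)).trans hD, ?_⟩
  suffices h : ∀ x y, x ≤ y → (D.filter (· ≤ x)).card = (D.filter (· ≤ y)).card → ∀ s < n,
      ⌊N * (f^[s] x : ℝ)⌋₊ = ⌊N * (f^[s] y : ℝ)⌋₊ by
    intro x y hxy s hs
    rcases le_total x y with hle | hle
    · exact h x y hle hxy s hs
    · exact (h y x hle hxy.symm s hs).symm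
  intro x y hxy hcard s hs
  have hfilter : D.filter (· ≤ x) = D.filter (· ≤ y) :=
    Finset.eq_of_subset_of_card_le (Finset.monotone_filter_right _ fun z _ hz => hz.trans hxy)
      hcard.ge
  have hcut : ∀ z, x < z → z ≤ y → ∀ s < n, ∀ e ∈ E, (f^[s] z : ℝ) ≠ e := by
    intro z hxz hzy s hs e he hze
    have hzD : z ∈ D.filter (· ≤ y) := Finset.mem_filter.2 ⟨Finset.mem_biUnion.2
      ⟨s, Finset.mem_range.2 hs, Finset.mem_preimage.2 (hze.symm ▸ he)⟩, hzy⟩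
    rw [← hfilter] at hzD
    exact absurd (Finset.mem_filter.1 hzD).2 hxz.not_ge
  have hpar := iterate_sub_eq_of_not_cut hξ0 hb hc (n := n) fun z h₁ h₂ s hs =>
    ⟨hcut z h₁ h₂ s hs ξ (by simp [E]), hcut z h₁ h₂ s hs (ξ + b) (by simp [E])⟩
  have hN' : (0 : ℝ) < N := by exact_mod_cast hN
  have hxy' : (x : ℝ) ≤ y := hxy
  change ∀ s ≤ n, ∀ z, x ≤ z → z ≤ y → (f^[s] z : ℝ) = f^[s] x + (z - x) at hpar
  have hy := hpar s hs.le y hxy le_rfl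
  refine le_antisymm (Nat.floor_le_floor (mul_le_mul_of_nonneg_left (by linarith) hN'.le)) ?_
  by_contra! hlt
  set j := ⌊N * (f^[s] y : ℝ)⌋₊ with hj
  have hfy := (f^[s] y).2
  have h₁ : (f^[s] x : ℝ) < j / N := by
    rw [lt_div_iff₀ hN', mul_comm]
    exact (Nat.floor_lt (mul_nonneg hN'.le (f^[s] x).2.1)).1 hlt
  have h₂ : (j : ℝ) / N ≤ f^[s] y := by
    rw [div_le_iff₀ hN', mul_comm]
    exact Nat.floor_le (mul_nonneg hN'.le hfy.1)
  let w : Set.Ico (0 : ℝ) (ξ + b + c) :=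
    ⟨x + (j / N - f^[s] x), by linarith [x.2.1], by linarith [y.2.2]⟩
  have hw₁ : x < w := show (x : ℝ) < x + (j / N - f^[s] x) by linarith
  have hw₂ : w ≤ y := show (x : ℝ) + (j / N - f^[s] x) ≤ y by linarith
  refine hcut w hw₁ hw₂ s hs (j / N) ?_ ?_
  · refine Finset.mem_union_left _ (Finset.mem_image.2 ⟨j, Finset.mem_range.2 ?_, rfl⟩)
    have h₃ : (j : ℝ) / N < 2 := by linarith [hfy.2]
    rw [div_lt_iff₀ hN'] at h₃
    have : j < 2 * N := by exact_mod_cast h₃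
    omega
  · rw [hpar s hs.le w hw₁.le hw₂]
    simp [w]

end Complexity

/-! ### Covering numbers from codings -/

section Cover

variable {X : Type*} [MeasurableSpace X] {μ : Measure X} {f : X → X} {k : ℕ}

/-- Markov's inequality for the number of visits to a set. -/
theorem mul_measure_le_card_visits_le (hf : Measurable f)
    (hμ : ∀ s, ∀ S : Set X, MeasurableSet S → μ (f^[s] ⁻¹' S) ≤ μ S) {B : Set X}
    [DecidablePred (· ∈ B)] (hB : MeasurableSet B) (n : ℕ) (a : ℝ≥0∞) :
    a * μ {x | a ≤ (((Finset.range n).filter fun s => f^[s] x ∈ B).card : ℝ≥0∞)} ≤ n * μ B := by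
  have hcount : ∀ x, (((Finset.range n).filter fun s => f^[s] x ∈ B).card : ℝ≥0∞) =
      ∑ s ∈ Finset.range n, (f^[s] ⁻¹' B).indicator 1 x := by
    intro x
    rw [Finset.card_filter]
    push_cast
    refine Finset.sum_congr rfl fun s _ => ?_
    by_cases h : f^[s] x ∈ B
    · rw [if_pos h, Set.indicator_of_mem (Set.mem_preimage.2 h), Pi.one_apply]
    · rw [if_neg h, Set.indicator_of_notMem (mt Set.mem_preimage.1 h)]
  have hm : ∀ s, MeasurableSet (f^[s] ⁻¹' B) := fun s => hf.iterate s hB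
  simp only [hcount]
  refine (mul_meas_ge_le_lintegral (Finset.measurable_sum _ fun s _ =>
    measurable_one.indicator (hm s)) a).trans ?_
  rw [lintegral_finsetSum _ fun s _ => measurable_one.indicator (hm s)]
  refine (Finset.sum_le_card_nsmul _ _ (μ B) fun s _ => ?_).trans (by simp)
  rw [lintegral_indicator_one (hm s)]
  exact hμ s B hB

/-- If most orbits follow, up to few errors, one of `M + 1` itineraries, then the covering number is
at most `M + 1`. -/
theorem coverNumber_le_of_coding [Nonempty X] {P Q : X → Fin k} {ε : ℝ} {n M : ℕ} (hn : 0 < n)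
    {code : X → ℕ} (hM : ∀ x, code x ≤ M)
    (hcode : ∀ x y, code x = code y → ∀ s < n, Q (f^[s] x) = Q (f^[s] y))
    {W : Set X} (hW : ∀ x ∈ W, 2 * (((Finset.range n).filter fun s =>
      P (f^[s] x) ≠ Q (f^[s] x)).card : ℝ) < ε * n)
    (hμW : ∀ S : Set X, W ⊆ S → 1 - ε < μ.real S) :
    coverNumber μ f P ε n ≤ (M + 1 : ℕ) := by
  classical
  -- Representatives must lie in `W`, since the errors of the centre count as well; codes not
  -- attained on `W` get an arbitrary point.
  have hrep : ∀ i : ℕ, ∃ z : X, (∃ x ∈ W, code x = i) → z ∈ W ∧ code z = i := fun i => by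
    by_cases h : ∃ x ∈ W, code x = i
    · obtain ⟨x, hx⟩ := h
      exact ⟨x, fun _ => hx⟩
    · exact ⟨Classical.arbitrary X, fun h' => absurd h' h⟩
  choose rep hrep using hrep
  have hn' : (0 : ℝ) < n := by exact_mod_cast hn
  refine (iInf₂_le ((Finset.range (M + 1)).image rep) (hμW _ fun x hx => ?_)).trans ?_
  · obtain ⟨hz, hzc⟩ := hrep (code x) ⟨x, hx, rfl⟩
    refine Set.mem_biUnion (x := rep (code x)) (Finset.mem_coe.2 (Finset.mem_image_of_mem _
      (Finset.mem_range.2 (Nat.lt_succ_of_le (hM x))))) ?_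
    refine lt_of_mul_lt_mul_right ?_ hn'.le
    rw [← card_filter_ne f P hn]
    have hsub : ((Finset.range n).filter fun s => P (f^[s] (rep (code x))) ≠ P (f^[s] x)) ⊆
        ((Finset.range n).filter fun s => P (f^[s] (rep (code x))) ≠ Q (f^[s] (rep (code x)))) ∪
          (Finset.range n).filter fun s => P (f^[s] x) ≠ Q (f^[s] x) := by
      intro s hs
      simp only [Finset.mem_filter, Finset.mem_union, Finset.mem_range] at hs ⊢
      have := hcode _ _ hzc s hs.1
      by_contra! hcon
      exact hs.2 ((hcon.1 hs.1).trans (this.trans (hcon.2 hs.1).symm))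
    have hle : (((Finset.range n).filter fun s =>
        P (f^[s] (rep (code x))) ≠ P (f^[s] x)).card : ℝ) ≤
        (((Finset.range n).filter fun s =>
          P (f^[s] (rep (code x))) ≠ Q (f^[s] (rep (code x)))).card +
          ((Finset.range n).filter fun s => P (f^[s] x) ≠ Q (f^[s] x)).card : ℕ) := by
      exact_mod_cast (Finset.card_le_card hsub).trans (Finset.card_union_le _ _)
    push_cast at hle
    linarith [hW _ hz, hW x hx]
  · have := (Finset.card_image_le (s := Finset.range (M + 1)) (f := rep))
    rw [Finset.card_range] at this
    exact_mod_cast this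

/-- For `χ > 1` the quotient is at most `(E + 1) n ^ (-(χ - 1))`, which tends to `0`. -/
theorem criticalExponent_le_one {P : X → Fin k} {ε : ℝ} {E : ℕ}
    (h : ∀ n : ℕ, 0 < n → coverNumber μ f P ε n ≤ (E * n + 1 : ℕ)) :
    criticalExponent polynomialScale μ f P ε ≤ 1 := by
  refine iSup₂_le fun χ hχ => ?_
  by_contra! hχ1
  have hχ1' : (1 : ℝ) < χ := by exact_mod_cast hχ1
  refine hχ.ne' ?_
  have hlim : Tendsto (fun n : ℕ => ENNReal.ofReal ((E + 1) * (n : ℝ) ^ (-(χ - 1 : ℝ)))) atTop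
      (𝓝 0) := by
    have h₁ := ((tendsto_rpow_neg_atTop (sub_pos.2 hχ1')).comp
      (tendsto_natCast_atTop_atTop (R := ℝ))).const_mul ((E : ℝ) + 1)
    simpa using ENNReal.tendsto_ofReal h₁
  refine (tendsto_of_tendsto_of_tendsto_of_le_of_le' tendsto_const_nhds hlim
    (Eventually.of_forall fun _ => zero_le) ?_).limsup_eq
  filter_upwards [eventually_gt_atTop 0] with n hn
  have hn' : (0 : ℝ) < n := by exact_mod_cast hn
  have hn1 : (1 : ℝ) ≤ n := by exact_mod_cast hn
  have hpos : 0 < polynomialScale χ n := Real.rpow_pos_of_pos hn' _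
  calc (coverNumber μ f P ε n : ℝ≥0∞) / ENNReal.ofReal (polynomialScale χ n)
      ≤ ENNReal.ofReal (E * n + 1) / ENNReal.ofReal (polynomialScale χ n) := by
        gcongr
        have h₁ := ENat.toENNReal_le.2 (h n hn)
        rw [ENat.toENNReal_coe, ← ENNReal.ofReal_natCast] at h₁
        exact_mod_cast h₁
    _ = ENNReal.ofReal ((E * n + 1) / polynomialScale χ n) :=
        (ENNReal.ofReal_div_of_pos hpos).symm
    _ ≤ _ := by
        refine ENNReal.ofReal_le_ofReal ?_
        rw [div_le_iff₀ hpos, polynomialScale, mul_assoc, ← Real.rpow_add hn',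
          show -((χ : ℝ) - 1) + χ = 1 by ring, Real.rpow_one]
        nlinarith

end Cover

theorem metricSlowEntropy_threeIET_le_one {ξ b c : ℝ} (hξ0 : 0 < ξ) (hξ1 : ξ < 1) (hb : 0 < b)
    (hc : 0 < c) (hbc : b + c = 1) :
    metricSlowEntropy polynomialScale (normalizedLebesgue (ξ + b + c))
      (threeIET ξ b c hξ0 hb hc) ≤ 1 := by
  classical
  have hprob := isProbabilityMeasure_normalizedLebesgue (L := ξ + b + c) (by positivity)
  refine iSup_le fun k => iSup₂_le fun P hP => ?_
  refine (limsup_le_limsup (v := fun _ => 1) ?_).trans (limsup_const 1).le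
  filter_upwards [self_mem_nhdsWithin] with ε hε
  have hε0 : 0 < ε := hε
  set μ := normalizedLebesgue (ξ + b + c)
  set f := threeIET ξ b c hξ0 hb hc
  have hne : Nonempty (Set.Ico (0 : ℝ) (ξ + b + c)) := ⟨⟨0, le_rfl, by positivity⟩⟩
  -- With `δ = ε² / 4`, Markov's inequality at the threshold `ε n / 2` discards a set of measure at
  -- most `ε / 2`. The two halves `ε / 2` of the errors, from the point and its centre, add up to
  -- `ε`.
  obtain ⟨N, g, hN, hg⟩ := exists_cell_approximation (L := ξ + b + c) (by linarith) hP
    (δ := ε ^ 2 / 4) (by positivity)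
  obtain ⟨E, hE⟩ := exists_linear_coding hξ0 hb hc hξ1 hbc hN
  refine criticalExponent_le_one (E := E) fun n hn => ?_
  obtain ⟨code, hcode, hcode'⟩ := hE n
  have hn' : (0 : ℝ) < n := by exact_mod_cast hn
  set Q : Set.Ico (0 : ℝ) (ξ + b + c) → Fin k := fun x => g ⌊N * (x : ℝ)⌋₊ with hQ
  have hQm : Measurable Q :=
    (measurable_from_top (f := g)).comp (Nat.measurable_floor.comp (by fun_prop))
  set B : Set (Set.Ico (0 : ℝ) (ξ + b + c)) := {x | P x ≠ Q x} with hB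
  have hBm : MeasurableSet B := (measurableSet_eq_fun hP hQm).compl
  set V : Set (Set.Ico (0 : ℝ) (ξ + b + c)) := {x | ENNReal.ofReal (ε / 2 * n) ≤
    (((Finset.range n).filter fun s => f^[s] x ∈ B).card : ℝ≥0∞)} with hV
  have hmarkov := mul_measure_le_card_visits_le (μ := μ) (measurable_threeIET hξ0 hb hc)
    (fun s S hS => normalizedLebesgue_preimage_iterate_le hξ0 hb hc s hS) hBm n
    (ENNReal.ofReal (ε / 2 * n))
  have hVε : μ.real V ≤ ε / 2 := by
    have h₁ := ENNReal.toReal_mono (by finiteness) hmarkov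
    have h₂ : μ.real B ≤ ε ^ 2 / 4 := ENNReal.toReal_le_of_le_ofReal (by positivity) hg
    rw [ENNReal.toReal_mul, ENNReal.toReal_mul, ENNReal.toReal_ofReal (by positivity),
      ENNReal.toReal_natCast] at h₁
    have h₃ : ε / 2 * n * μ.real V ≤ n * μ.real B := h₁
    have h₄ : (ε * n / 2) * μ.real V ≤ (ε * n / 2) * (ε / 2) := by nlinarith
    exact le_of_mul_le_mul_left h₄ (by positivity)
  refine coverNumber_le_of_coding (Q := Q) (W := Vᶜ) hn hcode
    (fun x y hxy s hs => congrArg g (hcode' x y hxy s hs)) (fun x hx => ?_) fun S hS => ?_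
  · have h₁ : (((Finset.range n).filter fun s => f^[s] x ∈ B).card : ℝ≥0∞) <
      ENNReal.ofReal (ε / 2 * n) := not_le.1 hx
    rw [← ENNReal.ofReal_natCast, ENNReal.ofReal_lt_ofReal_iff (by positivity)] at h₁
    have h₂ : (((Finset.range n).filter fun s => P (f^[s] x) ≠ Q (f^[s] x)).card : ℝ) <
      ε / 2 * n := h₁
    linarith
  · have h₁ : μ.real Set.univ ≤ μ.real V + μ.real S := by
      refine (measureReal_mono ?_).trans (measureReal_union_le V S)
      intro x _
      by_cases hx : x ∈ V
      · exact Or.inl hx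
      · exact Or.inr (hS hx)
    rw [probReal_univ] at h₁
    linarith

end SlowEntropy

theorem mainTheorem5 (ξ b c : ℝ) (hξ0 : 0 < ξ) (hξ1 : ξ < 1) (hb : 0 < b) (hc : 0 < c)
    (hbc : b + c = 1)
    (hα : SlowEntropy.BadlyApproximable (SlowEntropy.rotationNumber ξ c))
    (hξ : ξ ∈ SlowEntropy.wellSeparated (SlowEntropy.rotationNumber ξ c)) :
    SlowEntropy.metricSlowEntropy SlowEntropy.polynomialScale
      (SlowEntropy.normalizedLebesgue (ξ + b + c))
      (SlowEntropy.threeIET ξ b c hξ0 hb hc) = 1 := by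
  refine le_antisymm (SlowEntropy.metricSlowEntropy_threeIET_le_one hξ0 hξ1 hb hc hbc)
    (SlowEntropy.one_le_metricSlowEntropy_threeIET hξ0 hξ1 hb hc hbc ?_ ?_ hα hξ)
  -- For `c = ξ` the rotation number is the integer `1`, contrary to irrationality.
  · rintro rfl
    refine hα.1 ⟨1, ?_⟩
    simp [SlowEntropy.rotationNumber]
  · rw [SlowEntropy.rotationNumber]
    split_ifs
    · exact ⟨0, by simp⟩
    · exact ⟨1, by push_cast; ring⟩
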